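/- Setting. Let $X_1,X_2,\ldots$ be i.i.d. with law $P_0$ on a measurable space $\mathscr X$, let $\Theta$ be a parameter set, and let $\rho_\theta:\mathscr X\to\mathbb R^{d_\rho}$ $(\theta\in\Theta)$ be measurable and $P_0$-integrable moment functions. Put $g(\theta)=E[\rho_\theta(X_i)]$, $\Theta_I=\{\theta\in\Theta: g(\theta)=0\}$, $\Theta_I^\varepsilon=\{\theta\in\Theta:\|g(\theta)\|\le\varepsilon\}$, $\mathcal G=\{g(\theta):\theta\in\Theta\}$, $\rho_n(\theta)=\frac1n\sum_{i=1}^n\rho_\theta(X_i)$, and $\mathbb G_n f=\sqrt n\,\bigl(\frac1n\sum_{i=1}^n f(X_i)-E[f(X_i)]\bigr)$. A class of square-integrable functions is Donsker if the empirical process indexed by it converges weakly (in the Hoffmann-Jørgensen sense) in $\ell^\infty$ of the class to a tight Borel limit; a class of vector-valued functions is Donsker if the class of its coordinate functions is. Let $\mathcal T\subseteq\mathbb R^{d_\rho}$ be a closed convex cone and $\mathbb T$ the metric projection onto $\mathcal T$. Assume that: (a) there is $\varepsilon_0>0$ such that $\{\rho_\theta:\theta\in\Theta_I^{\varepsilon_0}\}$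 is Donsker; (b) $E[\rho_\theta(X_i)\rho_\theta(X_i)']=\Omega$ for each $\theta\in\Theta_I$, and $\Omega$ is (symmetric) positive definite; (c) there is $\theta^*\in\Theta_I$ such that $\sup_{\theta\in\Theta_I^\varepsilon}E[\|\rho_\theta(X_i)-\rho_{\theta^*}(X_i)\|^2]\to0$ as $\varepsilon\to0$; (d) there is $\delta>0$ such that $\sup_{\theta\in\Theta_I^\varepsilon}\|g(\theta)-\mathbb T g(\theta)\|=o(\varepsilon^{1+\delta})$ as $\varepsilon\to0$. Let $d^*\le d_\rho$ be such that for every $v\in\mathrm{Span}(\mathcal T)$ the last $d_\rho-d^*$ entries of $\Omega^{-1/2}v$ vanish (this normalization can always be achieved by rotating the moment functions), and let $[\,\cdot\,]_1$ denote the first $d^*$ entries of a vector. Consider the continuously-updated GMM criterion $$L_n(\theta)=-\tfrac12\,\rho_n(\theta)'W_n(\theta)\rho_n(\theta),\qquad W_n(\theta)=\Bigl(\tfrac1n\sum_{i=1}^n\rho_\theta(X_i)\rho_\theta(X_i)'-\rho_n(\theta)\rho_n(\theta)'\Bigr)^{-},$$ where $A^-$ is any generalized inverse of $A$ (i.e.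 $AA^-A=A$). Put $Z_n=\mathbb G_n(\rho_{\theta^*})$, $\ell_n=-\frac12Z_n'\Omega^{-1}Z_n$, $\gamma(\theta)=[\Omega^{-1/2}\,\mathbb T g(\theta)]_1$, $\mathbb V_n=-[\Omega^{-1/2}Z_n]_1$ and $\sqrt n\,\hat\gamma_n=\mathbb V_n$. Then $\gamma(\theta)=0$ if and only if $\theta\in\Theta_I$, for all $\theta$ in some $\Theta_I^\varepsilon$ with $\varepsilon>0$, and there is a positive sequence $r_n\to\infty$ with $r_n=o(n^{1/4})$ such that, with $\Theta_{osn}=\{\theta\in\Theta:\|g(\theta)\|\le r_n/\sqrt n\}$, the variables $\ell_n$, $\hat\gamma_n$ are measurable functions of $X_1,\ldots,X_n$ and $$\sup_{\theta\in\Theta_{osn}}\Bigl|nL_n(\theta)-\Bigl(\ell_n+\tfrac12\|\sqrt n\hat\gamma_n\|^2-\tfrac12\|\sqrt n(\hat\gamma_n-\gamma(\theta))\|^2\Bigr)\Bigr|=o_{\mathbb P}(1),$$ $$\sup_{\theta\in\Theta_{osn}}\|\gamma(\theta)\|\to0,\qquad \sqrt n\,\hat\gamma_n=\mathbb V_n\rightsquigarrow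 N(0,\Sigma),\quad \Sigma=I_{d^*}$$ (with $o_{\mathbb P}(1)$ understood in outer probability). If $\mathcal G$ contains a neighbourhood of the origin, then $d^*=d_\rho$, $\mathbb T g(\theta)=g(\theta)$ for every $\theta\in\Theta$, and these statements hold with $\gamma(\theta)=\Omega^{-1/2}g(\theta)$ and $\sqrt n\,\hat\gamma_n=\mathbb V_n=-\Omega^{-1/2}Z_n$. If, moreover, (e) $\widehat W_n$ are random matrices with $\|\widehat W_n-\Omega^{-1}\|=o_{\mathbb P}(1)$, then the same conclusions (with a possibly different sequence $r_n$) hold for the optimally-weighted GMM criterion $L_n(\theta)=-\frac12\rho_n(\theta)'\widehat W_n\rho_n(\theta)$. -/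

import Mathlib

open MeasureTheory ProbabilityTheory Filter Topology Asymptotics
open scoped ENNReal MatrixOrder

noncomputable section

namespace GMM

/-! ### Empirical processes and Donsker classes -/

/-- The empirical process `𝔾ₙ f = √n (ℙₙ f - P f)` evaluated at the sample `x`. -/
def empiricalProcess {𝒳 E : Type*} [MeasurableSpace 𝒳] [NormedAddCommGroup E] [NormedSpace ℝ E]
    (P : Measure 𝒳) (n : ℕ) (x : Fin n → 𝒳) (f : 𝒳 → E) : E :=
  Real.sqrt n • ((n : ℝ)⁻¹ • ∑ i, f (x i) - ∫ y, f y ∂P)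

/-- Outer expectation `E* f = inf {E u : u ≥ f, u measurable and integrable}` (used for bounded
functions `f` which need not be measurable). -/
def outerExpectation {α : Type*} [MeasurableSpace α] (μ : Measure α) (f : α → ℝ) : ℝ :=
  sInf {c : ℝ | ∃ u : α → ℝ, Measurable u ∧ Integrable u μ ∧ (∀ a, f a ≤ u a) ∧ c = ∫ a, u a ∂μ}

/-- The space `ℓ^∞(F)` of bounded real functions on the set `F`, with the supremum norm. -/
abbrev EllInfty {𝒳 : Type*} (F : Set (𝒳 → ℝ)) : Type _ := lp (fun _ : F => ℝ) ∞

/-- Weak convergence (Hoffmann-Jørgensen) of arbitrary maps `Zₙ` defined on probability spaces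
`(αₙ, μₙ)` to a tight Borel law on a metric space `E`:
`E* h(Zₙ) → ∫ h dν` for every bounded continuous `h`. -/
def WeakConvergesToTight {α : ℕ → Type*} [∀ n, MeasurableSpace (α n)] {E : Type*}
    [PseudoMetricSpace E] (μ : ∀ n, Measure (α n)) (Z : ∀ n, α n → E) : Prop :=
  letI : MeasurableSpace E := borel E
  ∃ ν : Measure E, IsProbabilityMeasure ν ∧ IsTightMeasureSet {ν} ∧
    ∀ h : BoundedContinuousFunction E ℝ,
      Tendsto (fun n => outerExpectation (μ n) (fun a => h (Z n a))) atTop (𝓝 (∫ z, h z ∂ν))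

/-- `F` is a `P`-Donsker class: it consists of measurable, square-integrable functions, the
empirical process `f ↦ 𝔾ₙ f` of `n` independent draws from `P` has its sample paths in `ℓ^∞(F)`, and
it converges weakly in `ℓ^∞(F)` to a tight Borel limit. -/
def IsDonsker {𝒳 : Type*} [MeasurableSpace 𝒳] (P : Measure 𝒳) (F : Set (𝒳 → ℝ)) : Prop :=
  (∀ f ∈ F, Measurable f ∧ MemLp f 2 P) ∧
    ∃ G : ∀ n, (Fin n → 𝒳) → EllInfty F,
      (∀ n x (f : F), G n x f = empiricalProcess P n x f.1) ∧
      WeakConvergesToTight (fun n => Measure.pi fun _ : Fin n => P) G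

/-! ### Closed convex cones -/

lemma exists_nearest {E : Type*} [NormedAddCommGroup E] [InnerProductSpace ℝ E] [CompleteSpace E]
    (C : ProperCone ℝ E) (v : E) : ∃ w ∈ (C : Set E), ‖v - w‖ = ⨅ u : (C : Set E), ‖v - u‖ :=
  exists_norm_eq_iInf_of_complete_convex C.nonempty C.isClosed.isComplete C.convex v

/-- Metric projection onto a closed convex cone. -/
def coneProj {E : Type*} [NormedAddCommGroup E] [InnerProductSpace ℝ E] [CompleteSpace E]
    (C : ProperCone ℝ E) (v : E) : E :=
  (exists_nearest C v).choose

/-! ### Data and the local quadratic approximation -/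

/-- `X₀, X₁, …` are independent draws from `P₀`, defined on the probability space `(S, Pr)`. -/
structure IsIIDSample {S 𝒳 : Type*} [MeasurableSpace S] [MeasurableSpace 𝒳] (Pr : Measure S)
    (P₀ : Measure 𝒳) (X : ℕ → S → 𝒳) : Prop where
  indep : iIndepFun X Pr
  law : ∀ i, MeasurePreserving (X i) Pr P₀

/-- The first `n` observations. -/
def sample {S 𝒳 : Type*} (X : ℕ → S → 𝒳) (n : ℕ) (ω : S) : Fin n → 𝒳 := fun i => X i ω

/-- Local quadratic approximation of the criterion `Lₙ` over the sets `Θₒₛₙ`, with local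
reduced-form parameter `γ`, centring `ℓₙ`, vectors `γ̂ₙ` and `Vₙ` (measurable functions of the
first `n` observations), closed convex cone `T` and asymptotic variance `Σ`. The remainder is
`o_Pr(1)` in outer probability, so the supremum need not be measurable. -/
structure LocalQuadraticApproximation {S 𝒳 Θ : Type*} [MeasurableSpace S] [MeasurableSpace 𝒳]
    (Pr : Measure S) [IsProbabilityMeasure Pr] (X : ℕ → S → 𝒳) {d : ℕ}
    (L : ℕ → S → Θ → ℝ) (Θosn : ℕ → Set Θ) (γ : Θ → EuclideanSpace ℝ (Fin d))
    (ℓ : ∀ n, (Fin n → 𝒳) → ℝ) (γhat V : ∀ n, (Fin n → 𝒳) → EuclideanSpace ℝ (Fin d))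
    (T : ProperCone ℝ (EuclideanSpace ℝ (Fin d))) (Sig : Matrix (Fin d) (Fin d) ℝ) : Prop where
  measurable_ell : ∀ n, Measurable (ℓ n)
  measurable_gammaHat : ∀ n, Measurable (γhat n)
  measurable_V : ∀ n, Measurable (V n)
  expansion : ∀ ε : ℝ, 0 < ε → Tendsto (fun n : ℕ => Pr {ω | ENNReal.ofReal ε <
      ⨆ θ ∈ Θosn n, ENNReal.ofReal |n * L n ω θ - (ℓ n (sample X n ω)
        + 1 / 2 * ‖Real.sqrt n • γhat n (sample X n ω)‖ ^ 2
        - 1 / 2 * ‖Real.sqrt n • (γhat n (sample X n ω) - γ θ)‖ ^ 2)|}) atTop (𝓝 0)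
  gamma_small : Tendsto (fun n => ⨆ θ ∈ Θosn n, ‖γ θ‖ₑ) atTop (𝓝 0)
  gammaHat_eq : ∀ (n : ℕ) (x : Fin n → 𝒳), Real.sqrt (n : ℝ) • γhat n x = coneProj T (V n x)
  V_tendsto : TendstoInDistribution (fun n ω => V n (sample X n ω)) atTop
    (id : EuclideanSpace ℝ (Fin d) → EuclideanSpace ℝ (Fin d)) (fun _ => Pr)
    (multivariateGaussian 0 Sig)

/-! ### Moment-equality models -/

section Model

variable {𝒳 Θ : Type*} {k : ℕ}

/-- The population moment `g(θ) = E[ρ_θ(X)]`. -/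
def popMoment [MeasurableSpace 𝒳] (P₀ : Measure 𝒳) (ρ : Θ → 𝒳 → EuclideanSpace ℝ (Fin k))
    (θ : Θ) : EuclideanSpace ℝ (Fin k) :=
  ∫ y, ρ θ y ∂P₀

/-- The identified set `Θ_I = {θ : g(θ) = 0}`. -/
def identifiedSet [MeasurableSpace 𝒳] (P₀ : Measure 𝒳)
    (ρ : Θ → 𝒳 → EuclideanSpace ℝ (Fin k)) : Set Θ :=
  {θ | popMoment P₀ ρ θ = 0}

/-- The enlargement `Θ_I^ε = {θ : ‖g(θ)‖ ≤ ε}`. -/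
def enlargement [MeasurableSpace 𝒳] (P₀ : Measure 𝒳)
    (ρ : Θ → 𝒳 → EuclideanSpace ℝ (Fin k)) (ε : ℝ) : Set Θ :=
  {θ | ‖popMoment P₀ ρ θ‖ ≤ ε}

/-- The coordinate functions of the moment functions with parameter in `A`; a class of
vector-valued functions is Donsker when the class of its coordinates is. -/
def momentClass (ρ : Θ → 𝒳 → EuclideanSpace ℝ (Fin k)) (A : Set Θ) : Set (𝒳 → ℝ) :=
  {f | ∃ θ ∈ A, ∃ j : Fin k, f = fun y => ρ θ y j}

/-- The sample moment `ρₙ(θ) = n⁻¹ ∑ ρ_θ(Xᵢ)`. -/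
def sampleMoment (ρ : Θ → 𝒳 → EuclideanSpace ℝ (Fin k)) (n : ℕ) (x : Fin n → 𝒳) (θ : Θ) :
    EuclideanSpace ℝ (Fin k) :=
  (n : ℝ)⁻¹ • ∑ i, ρ θ (x i)

/-- The sample variance `n⁻¹ ∑ ρ_θ(Xᵢ) ρ_θ(Xᵢ)' - ρₙ(θ) ρₙ(θ)'`. -/
def sampleVariance (ρ : Θ → 𝒳 → EuclideanSpace ℝ (Fin k)) (n : ℕ) (x : Fin n → 𝒳) (θ : Θ) :
    Matrix (Fin k) (Fin k) ℝ :=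
  Matrix.of fun a b => (n : ℝ)⁻¹ * ∑ i, ρ θ (x i) a * ρ θ (x i) b
    - sampleMoment ρ n x θ a * sampleMoment ρ n x θ b

/-- `B` is a generalized inverse of `A`. -/
def IsGeneralizedInverse (A B : Matrix (Fin k) (Fin k) ℝ) : Prop := A * B * A = A

/-- The quadratic form `v' A v`. -/
def quadForm (A : Matrix (Fin k) (Fin k) ℝ) (v : EuclideanSpace ℝ (Fin k)) : ℝ :=
  v.ofLp ⬝ᵥ A.mulVec v.ofLp

/-- The GMM criterion `-½ ρₙ(θ)' W ρₙ(θ)` with weighting matrix `W`. -/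
def gmmCriterion (ρ : Θ → 𝒳 → EuclideanSpace ℝ (Fin k)) (W : Matrix (Fin k) (Fin k) ℝ)
    (n : ℕ) (x : Fin n → 𝒳) (θ : Θ) : ℝ :=
  -(1 / 2) * quadForm W (sampleMoment ρ n x θ)

/-- `Ω^{-1/2} v`, with the positive (semi)definite square root of `Ω⁻¹`. -/
def invSqrtMul (Ω : Matrix (Fin k) (Fin k) ℝ) (v : EuclideanSpace ℝ (Fin k)) :
    EuclideanSpace ℝ (Fin k) :=
  Matrix.toEuclideanCLM (𝕜 := ℝ) (CFC.sqrt Ω⁻¹) v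

/-- The upper `d` entries `[v]₁` of a vector `v`. -/
def upper {d : ℕ} (hdk : d ≤ k) (v : EuclideanSpace ℝ (Fin k)) : EuclideanSpace ℝ (Fin d) :=
  WithLp.toLp 2 fun i => v (Fin.castLE hdk i)

/-- The conclusion for a criterion `L`: there are `rₙ → ∞`, `rₙ = o(n^{1/4})`, such that the local
quadratic approximation holds over `Θₒₛₙ = {θ : ‖g(θ)‖ ≤ rₙ/√n}` with `Zₙ = 𝔾ₙ(ρ_θ*)`,
`ℓₙ = -½ Zₙ' Ω⁻¹ Zₙ`, `γ(θ) = [Ω^{-1/2} 𝕋g(θ)]₁`, `√n γ̂ₙ = Vₙ = -[Ω^{-1/2} Zₙ]₁` and `Σ = I`;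
moreover `γ` vanishes exactly on `Θ_I` near `Θ_I`. If `{g(θ)}` contains a neighbourhood of the
origin, then `d = k`, `𝕋g(θ) = g(θ)`, and the approximation reads with `γ(θ) = Ω^{-1/2} g(θ)` and
`√n γ̂ₙ = Vₙ = -Ω^{-1/2} Zₙ`. Since `√n γ̂ₙ` equals `Vₙ`, the cone onto which `Vₙ` is projected is
the whole space. -/
def HasLocalGMMExpansion [MeasurableSpace 𝒳] {S : Type*} [MeasurableSpace S] (Pr : Measure S)
    [IsProbabilityMeasure Pr] (P₀ : Measure 𝒳) (X : ℕ → S → 𝒳)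
    (ρ : Θ → 𝒳 → EuclideanSpace ℝ (Fin k)) (Ω : Matrix (Fin k) (Fin k) ℝ)
    (𝒯 : ProperCone ℝ (EuclideanSpace ℝ (Fin k))) {d : ℕ} (hdk : d ≤ k) (θstar : Θ)
    (L : ℕ → S → Θ → ℝ) : Prop :=
  let Z : ∀ n, (Fin n → 𝒳) → EuclideanSpace ℝ (Fin k) :=
    fun n x => empiricalProcess P₀ n x (ρ θstar)
  let ℓ : ∀ n, (Fin n → 𝒳) → ℝ := fun n x => -(1 / 2) * quadForm Ω⁻¹ (Z n x)
  let γ : Θ → EuclideanSpace ℝ (Fin d) :=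
    fun θ => upper hdk (invSqrtMul Ω (coneProj 𝒯 (popMoment P₀ ρ θ)))
  let V : ∀ n, (Fin n → 𝒳) → EuclideanSpace ℝ (Fin d) :=
    fun n x => -upper hdk (invSqrtMul Ω (Z n x))
  let γfull : Θ → EuclideanSpace ℝ (Fin k) := fun θ => invSqrtMul Ω (popMoment P₀ ρ θ)
  let Vfull : ∀ n, (Fin n → 𝒳) → EuclideanSpace ℝ (Fin k) := fun n x => -invSqrtMul Ω (Z n x)
  (∃ ε : ℝ, 0 < ε ∧ ∀ θ ∈ enlargement P₀ ρ ε, γ θ = 0 ↔ θ ∈ identifiedSet P₀ ρ) ∧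
  ∃ r : ℕ → ℝ, (∀ n, 0 < r n) ∧ Tendsto r atTop atTop ∧
    r =o[atTop] (fun n : ℕ => (n : ℝ) ^ (1 / 4 : ℝ)) ∧
    LocalQuadraticApproximation Pr X L (fun n => enlargement P₀ ρ (r n / Real.sqrt n)) γ ℓ
      (fun n x => (Real.sqrt n)⁻¹ • V n x) V ⊤ 1 ∧
    (Set.range (popMoment P₀ ρ) ∈ 𝓝 0 →
      d = k ∧ (∀ θ, coneProj 𝒯 (popMoment P₀ ρ θ) = popMoment P₀ ρ θ) ∧
      LocalQuadraticApproximation Pr X L (fun n => enlargement P₀ ρ (r n / Real.sqrt n)) γfull ℓ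
        (fun n x => (Real.sqrt n)⁻¹ • Vfull n x) Vfull ⊤ 1)

end Model

end GMM

end

noncomputable section

namespace GMM

/-! ### The empirical process and outer expectations -/

section EmpiricalProcess

variable {𝒳 : Type*} [MeasurableSpace 𝒳] {P : Measure 𝒳}

/-! The identity `√n ρ_n(θ) = 𝔾_n ρ_θ + √n g(θ)` turns `n L_n(θ)` into `-½` times a quadratic form
in `𝔾_n ρ_θ + √n g(θ)`. Uniformly over `‖g(θ)‖ ≤ K/√n`, with `K` fixed, three replacements cost
`o_P(1)`. Asymptotic equicontinuity (`IsDonsker.asymptotic_equicontinuity`) replaces `𝔾_n ρ_θ` by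
`Z_n`; condition (d) replaces `√n g` by `√n 𝕋g` (`exists_norm_sub_coneProj_le`); consistency of the
weights replaces `W` by `Ω⁻¹`. What remains is `-½ (Z_n + √n 𝕋g)' Ω⁻¹ (Z_n + √n 𝕋g)`. Because the
lower block of `Ω^{-1/2} 𝕋g` vanishes, expanding this square gives exactly the quadratic expression
claimed (`quadratic_approximation_eq`). A diagonal argument then lets `K` grow slowly with `n`
(`exists_radius`).

The delicate point is consistency of the continuously-updated weight, which needs empirical second
moments of `ρ_θ - ρ_θ*` to be uniformly small, with no envelope assumption. If `∑ h(x_i)²` is large,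
then a fixed fraction of all sign patterns makes the signed sum large (second and fourth moments of
random signs), so one of the two subsamples selected by the signs has a large centred sum.
Equicontinuity at the size of that subsample makes this improbable (`measure_second_moment_gt_le`).
Near `Ω` every generalized inverse is the inverse, and inversion is continuous
(`exists_generalizedInverse_close`).

The limit law is the central limit theorem for linear functionals combined with characteristic
functions. If `g` covers a neighbourhood of the origin, scaling invariance and closedness of the
cone force it to be the whole space (`mem_cone_of_range_mem_nhds`). -/

lemma empiricalProcess_sub {E : Type*} [NormedAddCommGroup E] [NormedSpace ℝ E] {n : ℕ}
    (x : Fin n → 𝒳) {f g : 𝒳 → E} (hf : Integrable f P) (hg : Integrable g P) :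
    empiricalProcess P n x (f - g) = empiricalProcess P n x f - empiricalProcess P n x g := by
  simp only [empiricalProcess, Pi.sub_apply, Finset.sum_sub_distrib]
  rw [integral_sub hf hg]
  module

lemma empiricalProcess_eq_sum [IsProbabilityMeasure P] {f : 𝒳 → ℝ} {n : ℕ} (x : Fin n → 𝒳) :
    empiricalProcess P n x f = (Real.sqrt n)⁻¹ * ∑ i, (f (x i) - ∫ y, f y ∂P) := by
  rcases Nat.eq_zero_or_pos n with rfl | hn
  · simp [empiricalProcess]
  have hn' : (0 : ℝ) < n := by exact_mod_cast hn
  have h1 : (0 : ℝ) < Real.sqrt n := Real.sqrt_pos.2 hn'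
  have h2 : Real.sqrt n * Real.sqrt n = n := Real.mul_self_sqrt hn'.le
  simp only [empiricalProcess, smul_eq_mul, Finset.sum_sub_distrib, Finset.sum_const,
    Finset.card_univ, Fintype.card_fin, nsmul_eq_mul]
  field_simp
  rw [Real.sq_sqrt hn'.le]

lemma measurable_empiricalProcess {E : Type*} [NormedAddCommGroup E] [NormedSpace ℝ E]
    [MeasurableSpace E] [BorelSpace E] [SecondCountableTopology E] {n : ℕ} {f : 𝒳 → E}
    (hf : Measurable f) :
    Measurable fun x : Fin n → 𝒳 => empiricalProcess P n x f := by
  unfold empiricalProcess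
  have : ∀ i, Measurable fun x : Fin n → 𝒳 => f (x i) :=
    fun i => hf.comp (measurable_pi_apply i)
  fun_prop

variable [IsProbabilityMeasure P]

lemma memLp_empiricalProcess {n : ℕ} {f : 𝒳 → ℝ} (hf : MemLp f 2 P) :
    MemLp (fun x : Fin n → 𝒳 => empiricalProcess P n x f) 2 (Measure.pi fun _ => P) := by
  simp_rw [empiricalProcess_eq_sum]
  have hg : MemLp (fun y => f y - ∫ z, f z ∂P) 2 P := hf.sub (memLp_const _)
  have hmem : ∀ i : Fin n, MemLp (fun x : Fin n → 𝒳 => f (x i) - ∫ z, f z ∂P) 2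
      (Measure.pi fun _ => P) :=
    fun i => hg.comp_measurePreserving (measurePreserving_eval (fun _ : Fin n => P) i)
  have hS : MemLp (fun x : Fin n → 𝒳 => ∑ i, (f (x i) - ∫ z, f z ∂P)) 2
      (Measure.pi fun _ => P) := by
    have := memLp_finsetSum' Finset.univ fun i _ => hmem i
    rwa [Finset.sum_fn] at this
  exact hS.const_mul _

/-- The second moment of `𝔾ₙ f` is at most that of `f`. -/
lemma integral_empiricalProcess_sq_le {n : ℕ} {f : 𝒳 → ℝ} (hf : MemLp f 2 P) :
    ∫ x : Fin n → 𝒳, (empiricalProcess P n x f) ^ 2 ∂(Measure.pi fun _ => P)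
      ≤ ∫ y, f y ^ 2 ∂P := by
  set m := ∫ y, f y ∂P
  have hg : MemLp (fun y => f y - m) 2 P := hf.sub (memLp_const _)
  have hgi : ∫ y, (f y - m) ∂P = 0 := by
    rw [integral_sub (hf.integrable one_le_two) (integrable_const _)]; simp [m]
  have hmem : ∀ i : Fin n, MemLp (fun x : Fin n → 𝒳 => f (x i) - m) 2 (Measure.pi fun _ => P) :=
    fun i => hg.comp_measurePreserving (measurePreserving_eval _ i)
  have hS : MemLp (∑ i, fun x : Fin n → 𝒳 => f (x i) - m) 2 (Measure.pi fun _ => P) :=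
    memLp_finsetSum' _ fun i _ => hmem i
  have hmean : (Measure.pi fun _ : Fin n => P)[∑ i, fun x : Fin n → 𝒳 => f (x i) - m] = 0 := by
    simp only [Finset.sum_apply]
    rw [integral_finsetSum _ fun i _ => (hmem i).integrable one_le_two]
    refine Finset.sum_eq_zero fun i _ => ?_
    rw [← hgi]
    exact (measurePreserving_eval (fun _ : Fin n => P) i).hasLaw.integral_comp
      hg.1
  -- Independence makes the variance of the sum `n` times a single variance; the factor `n` cancels
  -- against the squared normalization.
  have hvar := variance_sum_pi (μ := fun _ : Fin n => P) (X := fun _ y => f y - m) fun _ => hg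
  rw [variance_of_integral_eq_zero hS.1.aemeasurable hmean] at hvar
  have hv : Var[fun y => f y - m; P] ≤ ∫ y, f y ^ 2 ∂P := by
    rw [variance_sub_const hf.1]
    exact variance_le_expectation_sq hf.1
  simp_rw [empiricalProcess_eq_sum, mul_pow]
  rw [integral_const_mul]
  simp only [Finset.sum_apply] at hvar
  rw [hvar]
  rcases Nat.eq_zero_or_pos n with rfl | hn
  · simpa using integral_nonneg fun y => sq_nonneg (f y)
  have hn' : (0 : ℝ) < n := by exact_mod_cast hn
  rw [inv_pow, Real.sq_sqrt hn'.le]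
  simpa [← mul_assoc, inv_mul_cancel₀ hn'.ne'] using hv

lemma measure_empiricalProcess_gt_le {n : ℕ} {f : 𝒳 → ℝ} (hf : MemLp f 2 P)
    {η : ℝ} (hη : 0 < η) :
    (Measure.pi fun _ : Fin n => P) {x | η < |(empiricalProcess P n x f)|}
      ≤ ENNReal.ofReal ((∫ y, f y ^ 2 ∂P) / η ^ 2) := by
  have hI := (memLp_empiricalProcess (n := n) hf).integrable_sq
  have h := mul_meas_ge_le_integral_of_nonneg
    (Eventually.of_forall fun x => sq_nonneg (empiricalProcess P n x f)) hI (η ^ 2)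
  have h2 : (Measure.pi fun _ : Fin n => P).real {x | η < |(empiricalProcess P n x f)|} ≤
      (∫ y, f y ^ 2 ∂P) / η ^ 2 := by
    rw [le_div_iff₀ (by positivity), mul_comm]
    refine le_trans ?_ (h.trans (integral_empiricalProcess_sq_le hf))
    gcongr
    · simp
    · rename_i x
      intro hx
      rw [← sq_abs (empiricalProcess P n _ f)]
      exact pow_le_pow_left₀ hη.le (le_of_lt hx) 2
  rw [← ofReal_measureReal]
  exact ENNReal.ofReal_le_ofReal h2

end EmpiricalProcess

section OuterExpectation

variable {α : Type*} [MeasurableSpace α] {μ : Measure α}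

/-- Nonnegativity of `f` bounds the set of majorant integrals below, without which the real `sInf`
carries no information. -/
lemma outerExpectation_le {f : α → ℝ} (hf : ∀ a, 0 ≤ f a) {u : α → ℝ} (hu : Measurable u)
    (hui : Integrable u μ) (h : ∀ a, f a ≤ u a) : outerExpectation μ f ≤ ∫ a, u a ∂μ := by
  refine csInf_le ⟨0, ?_⟩ ⟨u, hu, hui, h, rfl⟩
  rintro c ⟨v, -, -, hv, rfl⟩
  exact integral_nonneg fun a => (hf a).trans (hv a)

/-- Markov's inequality for outer expectations. -/
lemma measure_ge_le_outerExpectation [IsProbabilityMeasure μ] {f : α → ℝ} (hf : ∀ a, 0 ≤ f a)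
    (hf1 : ∀ a, f a ≤ 1) {η : ℝ} (hη : 0 < η) : μ {a | η ≤ f a} ≤ ENNReal.ofReal (outerExpectation μ f / η) := by
  rw [← ofReal_measureReal]
  refine ENNReal.ofReal_le_ofReal ?_
  rw [le_div_iff₀ hη]
  -- Markov's inequality holds for every integrable majorant and passes to the infimum; the constant
  -- `1` shows that majorants exist.
  refine le_csInf ⟨_, fun _ => 1, measurable_const, integrable_const _, hf1, rfl⟩ ?_
  rintro c ⟨v, -, hvi, hv, rfl⟩
  refine le_trans ?_ (mul_meas_ge_le_integral_of_nonneg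
    (Eventually.of_forall fun a => (hf a).trans (hv a)) hvi η)
  rw [mul_comm]
  gcongr
  · simp
  · exact hv _

end OuterExpectation

/-! ### Asymptotic equicontinuity of the empirical process of a Donsker class -/

section Equicontinuity

variable {𝒳 : Type*} {F : Set (𝒳 → ℝ)}

lemma abs_apply_sub_le (z w : EllInfty F) (f : F) : |z f - w f| ≤ dist z w := by
  rw [dist_eq_norm, ← Real.norm_eq_abs]
  exact lp.norm_apply_le_norm ENNReal.top_ne_zero (z - w) f

/-- The truncated modulus `sup_{f ∈ A} min(|z f - z f₀|, 1)`. -/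
def truncatedModulus (f₀ : F) (A : Set F) (z : EllInfty F) : ℝ :=
  ⨆ f : A, min |z f - z f₀| 1

lemma bddAbove_truncatedModulus (f₀ : F) (A : Set F) (z : EllInfty F) :
    BddAbove (Set.range fun f : A => min |z f - z f₀| 1) :=
  ⟨1, by rintro _ ⟨f, rfl⟩; exact min_le_right _ _⟩

lemma truncatedModulus_nonneg (f₀ : F) (A : Set F) (z : EllInfty F) :
    0 ≤ truncatedModulus f₀ A z :=
  Real.iSup_nonneg fun _ => le_min (abs_nonneg _) zero_le_one

lemma truncatedModulus_le_one (f₀ : F) (A : Set F) (z : EllInfty F) :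
    truncatedModulus f₀ A z ≤ 1 :=
  Real.iSup_le (fun _ => min_le_right _ _) zero_le_one

lemma le_truncatedModulus (f₀ : F) {A : Set F} (z : EllInfty F) {f : F} (hf : f ∈ A) :
    min |z f - z f₀| 1 ≤ truncatedModulus f₀ A z :=
  le_ciSup (bddAbove_truncatedModulus f₀ A z) (⟨f, hf⟩ : A)

lemma truncatedModulus_singleton (f₀ f : F) (z : EllInfty F) :
    truncatedModulus f₀ {f} z = min |z f - z f₀| 1 := by
  simp [truncatedModulus]

/-- Each increment `z f - z f₀` moves by at most twice the sup distance, and neither truncation nor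
the supremum enlarges this. The modulus is thus a bounded Lipschitz test function for weak
convergence. -/
lemma truncatedModulus_le_add (f₀ : F) (A : Set F) (z w : EllInfty F) :
    truncatedModulus f₀ A z ≤ truncatedModulus f₀ A w + 2 * dist z w := by
  refine Real.iSup_le (fun f => ?_)
    (add_nonneg (truncatedModulus_nonneg f₀ A w) (by positivity))
  have h1 := le_truncatedModulus f₀ w f.2
  have h2 := abs_apply_sub_le z w f
  have h3 := abs_apply_sub_le z w f₀
  have h4 : |z f - z f₀| ≤ |w f - w f₀| + 2 * dist z w := by
    rw [abs_le] at h2 h3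
    have h5 := le_abs_self (w f - w f₀)
    have h6 := neg_abs_le (w f - w f₀)
    rw [abs_le]
    constructor <;> linarith [h2.1, h2.2, h3.1, h3.2]
  have h7 : (0 : ℝ) ≤ dist z w := dist_nonneg
  rcases le_total |w f - w f₀| 1 with h | h
  · rw [min_eq_left h] at h1
    exact (min_le_left _ _).trans (by linarith)
  · rw [min_eq_right h] at h1
    exact (min_le_right _ _).trans (by linarith)

lemma continuous_truncatedModulus (f₀ : F) (A : Set F) : Continuous (truncatedModulus f₀ A) :=
  (LipschitzWith.of_le_add_mul 2 fun z w => by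
    simpa using truncatedModulus_le_add f₀ A z w).continuous

/-- The truncated modulus as a bounded continuous function. -/
def truncatedModulusBCF (f₀ : F) (A : Set F) : BoundedContinuousFunction (EllInfty F) ℝ :=
  BoundedContinuousFunction.ofNormedAddCommGroup (truncatedModulus f₀ A)
    (continuous_truncatedModulus f₀ A) 1 fun z => by
      rw [Real.norm_of_nonneg (truncatedModulus_nonneg f₀ A z)]
      exact truncatedModulus_le_one f₀ A z

/-- If a tight law on `ℓ^∞(F)` satisfies `E min(|z f - z f₀|, 1) ≤ s f` for all `f`, then the
modulus over `{s ≤ δ}` is small on average as `δ → 0`. -/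
lemma exists_integral_truncatedModulus_le [MeasurableSpace (EllInfty F)] [BorelSpace (EllInfty F)]
    {ν : Measure (EllInfty F)} [IsProbabilityMeasure ν] (hν : IsTightMeasureSet {ν}) (f₀ : F)
    {s : F → ℝ} (hs : ∀ f, ∫ z, truncatedModulus f₀ {f} z ∂ν ≤ s f) {ε : ℝ} (hε : 0 < ε) :
    ∃ δ > 0, ∀ A : Set F, A.Nonempty → (∀ f ∈ A, s f ≤ δ) →
      ∫ z, truncatedModulus f₀ A z ∂ν ≤ ε := by
  obtain ⟨K, hK, hKc⟩ := isTightMeasureSet_iff_exists_isCompact_measure_compl_le.1 hν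
    (ENNReal.ofReal (ε / 7)) (by simpa using by positivity)
  replace hKc := hKc ν rfl
  obtain ⟨t, -, ht, hcover⟩ := hK.finite_cover_balls (e := ε / 7) (by positivity)
  have hint : ∀ A : Set F, Integrable (truncatedModulus f₀ A) ν := fun A =>
    (truncatedModulusBCF f₀ A).integrable ν
  -- `δ` depends only on the number of balls covering `K`. The nearly maximizing functions `c w`
  -- depend on `A`, but there is just one per centre.
  refine ⟨ε / 7 / (ht.toFinset.card + 1), by positivity, fun A hA hsA => ?_⟩
  have hex : ∀ z : EllInfty F, ∃ f ∈ A,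
      truncatedModulus f₀ A z ≤ truncatedModulus f₀ {f} z + ε / 7 := by
    intro z
    have : Nonempty A := hA.to_subtype
    obtain ⟨f, hf⟩ := exists_lt_of_lt_ciSup
      (show truncatedModulus f₀ A z - ε / 7 < ⨆ f : A, min |z f - z f₀| 1 by
        change _ < truncatedModulus f₀ A z; linarith)
    refine ⟨f, f.2, ?_⟩
    rw [truncatedModulus_singleton]
    linarith
  choose c hcA hc using hex
  have hbound : ∀ z, truncatedModulus f₀ A z ≤
      ∑ w ∈ ht.toFinset, truncatedModulus f₀ {c w} z + 5 * (ε / 7)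
        + Set.indicator Kᶜ (fun _ => (1 : ℝ)) z := by
    intro z
    by_cases hz : z ∈ K
    -- Passing from `z` to its centre and back costs `2ε/7` each way, and near-maximality of `c w`
    -- costs `ε/7`. The two remaining sevenths pay for the sum over centres and for the complement
    -- of `K`.
    · obtain ⟨w, hw, hzw⟩ := Set.mem_iUnion₂.1 (hcover hz)
      have hd : dist z w < ε / 7 := hzw
      have h1 := truncatedModulus_le_add f₀ A z w
      have h2 := hc w
      have h3 := truncatedModulus_le_add f₀ {c w} w z
      rw [dist_comm] at h3
      have h4 : truncatedModulus f₀ {c w} z ≤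
          ∑ w ∈ ht.toFinset, truncatedModulus f₀ {c w} z :=
        Finset.single_le_sum (f := fun w => truncatedModulus f₀ {c w} z)
          (fun w _ => truncatedModulus_nonneg _ _ _) (ht.mem_toFinset.2 hw)
      have h5 : 0 ≤ Set.indicator Kᶜ (fun _ => (1 : ℝ)) z :=
        Set.indicator_nonneg (fun _ _ => zero_le_one) _
      linarith
    · rw [Set.indicator_of_mem (show z ∈ Kᶜ from hz)]
      have := truncatedModulus_le_one f₀ A z
      have h4 : 0 ≤ ∑ w ∈ ht.toFinset, truncatedModulus f₀ {c w} z :=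
        Finset.sum_nonneg fun w _ => truncatedModulus_nonneg _ _ _
      linarith
  have hKm : MeasurableSet Kᶜ := hK.isClosed.measurableSet.compl
  have hind : Integrable (Set.indicator Kᶜ fun _ : EllInfty F => (1 : ℝ)) ν :=
    (integrable_const _).indicator hKm
  have hsum : Integrable (fun z => ∑ w ∈ ht.toFinset, truncatedModulus f₀ {c w} z) ν :=
    integrable_finsetSum _ fun w _ => hint _
  have hsum' : Integrable (fun z => ∑ w ∈ ht.toFinset, truncatedModulus f₀ {c w} z + 5 * (ε / 7))
      ν := hsum.add (integrable_const _)
  have h6 : ν.real Kᶜ ≤ ε / 7 := ENNReal.toReal_le_of_le_ofReal (by positivity) hKc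
  calc ∫ z, truncatedModulus f₀ A z ∂ν
      ≤ ∫ z, (∑ w ∈ ht.toFinset, truncatedModulus f₀ {c w} z + 5 * (ε / 7)
        + Set.indicator Kᶜ (fun _ => (1 : ℝ)) z) ∂ν :=
        integral_mono (hint A) (hsum'.add hind) hbound
    _ = ∑ w ∈ ht.toFinset, ∫ z, truncatedModulus f₀ {c w} z ∂ν + 5 * (ε / 7) + ν.real Kᶜ := by
        rw [integral_add hsum' hind,
          integral_add hsum (integrable_const _), integral_finsetSum _ fun w _ => hint _,
          integral_indicator hKm]
        simp
    _ ≤ ∑ w ∈ ht.toFinset, ε / 7 / (ht.toFinset.card + 1) + 5 * (ε / 7) + ε / 7 := by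
        gcongr with w
        exact (hs _).trans (hsA _ (hcA w))
    _ ≤ ε / 7 + 5 * (ε / 7) + ε / 7 := by
        gcongr
        rw [Finset.sum_const, nsmul_eq_mul, ← mul_div_assoc, div_le_iff₀ (by positivity)]
        nlinarith [show (0 : ℝ) ≤ ht.toFinset.card by positivity]
    _ = ε := by ring

/-- The empirical process of a Donsker class is asymptotically equicontinuous in `L²(P)`. -/
lemma IsDonsker.asymptotic_equicontinuity [MeasurableSpace 𝒳] {P : Measure 𝒳}
    [IsProbabilityMeasure P] (hF : IsDonsker P F) {f₀ : 𝒳 → ℝ} (hf₀ : f₀ ∈ F) {η ε : ℝ}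
    (hη : 0 < η) (hε : 0 < ε) :
    ∃ δ > 0, ∀ᶠ n in atTop, (Measure.pi fun _ : Fin n => P)
      {x | ∃ f ∈ F, ∫ y, (f y - f₀ y) ^ 2 ∂P ≤ δ ^ 2 ∧ η < |(empiricalProcess P n x (f - f₀))|}
        ≤ ENNReal.ofReal ε := by
  obtain ⟨hmem, G, hG, hconv⟩ := hF
  let : MeasurableSpace (EllInfty F) := borel _
  have : BorelSpace (EllInfty F) := ⟨rfl⟩
  obtain ⟨ν, hν, htight, hlim⟩ := hconv
  have hi : ∀ f ∈ F, Integrable f P := fun f hf => (hmem f hf).2.integrable one_le_two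
  have hGsub : ∀ n x (f : F), G n x f - G n x ⟨f₀, hf₀⟩ = empiricalProcess P n x (f.1 - f₀) := by
    intro n x f
    rw [hG, hG, empiricalProcess_sub x (hi _ f.2) (hi _ hf₀)]
  have hLp : ∀ f : F, MemLp (f.1 - f₀) 2 P := fun f => (hmem _ f.2).2.sub (hmem _ hf₀).2
  -- The limit law inherits the `L²` control of single increments. The majorant is `a ≤ δ/2 +
  -- a²/(2δ)`, whose mean is at most `δ` for every sample size.
  have hs0 : ∀ (f : F) (δ : ℝ), 0 < δ → ∫ y, (f.1 y - f₀ y) ^ 2 ∂P ≤ δ ^ 2 →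
      ∫ z, truncatedModulus ⟨f₀, hf₀⟩ {f} z ∂ν ≤ δ := by
    intro f δ hδ hfδ
    refine le_of_tendsto (hlim (truncatedModulusBCF ⟨f₀, hf₀⟩ {f}))
      (Eventually.of_forall fun n => ?_)
    have hL := memLp_empiricalProcess (n := n) (hLp f)
    have hle := integral_empiricalProcess_sq_le (n := n) (hLp f)
    refine (outerExpectation_le (fun x => truncatedModulus_nonneg _ _ _)
      (u := fun x => δ / 2 + (2 * δ)⁻¹ * (empiricalProcess P n x (f.1 - f₀)) ^ 2) ?_ ?_ ?_).trans ?_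
    · have := measurable_empiricalProcess (P := P) (n := n) ((hmem _ f.2).1.sub (hmem _ hf₀).1)
      fun_prop
    · exact (integrable_const _).add (hL.integrable_sq.const_mul _)
    · intro x
      rw [truncatedModulus_singleton, hGsub]
      refine (min_le_left _ _).trans ?_
      rw [← sq_abs]
      set a := |(empiricalProcess P n x (f.1 - f₀))|
      have : δ / 2 + (2 * δ)⁻¹ * a ^ 2 - a = (2 * δ)⁻¹ * (a - δ) ^ 2 := by
        field_simp; ring
      have h2 : 0 ≤ (2 * δ)⁻¹ * (a - δ) ^ 2 := by positivity
      linarith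
    · rw [integral_add (integrable_const _) (hL.integrable_sq.const_mul _), integral_const_mul]
      simp only [integral_const, probReal_univ, one_smul]
      have h3 : (2 * δ)⁻¹ * ∫ x : Fin n → 𝒳, (empiricalProcess P n x (f.1 - f₀)) ^ 2
          ∂(Measure.pi fun _ => P) ≤ (2 * δ)⁻¹ * δ ^ 2 := by
        gcongr
        exact hle.trans hfδ
      have h4 : (2 * δ)⁻¹ * δ ^ 2 = δ / 2 := by field_simp
      linarith
  -- The modulus is truncated at `1`, so an increment above `η` is only seen as a modulus of at
  -- least `min η 1`.
  have hmin : 0 < min η 1 := lt_min hη one_pos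
  obtain ⟨δ, hδ, hA⟩ := exists_integral_truncatedModulus_le htight ⟨f₀, hf₀⟩
    (s := fun f => ∫ z, truncatedModulus ⟨f₀, hf₀⟩ {f} z ∂ν) (fun f => le_rfl)
    (ε := min η 1 * ε / 2) (by positivity)
  refine ⟨δ, hδ, ?_⟩
  set A : Set F := {f | ∫ y, (f.1 y - f₀ y) ^ 2 ∂P ≤ δ ^ 2} with hAdef
  have hA' := hA A ⟨⟨f₀, hf₀⟩, by simp [hAdef]; positivity⟩ fun f hf => hs0 f δ hδ hf
  have hev : ∀ᶠ n in atTop, outerExpectation (Measure.pi fun _ : Fin n => P)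
      (fun x => truncatedModulusBCF ⟨f₀, hf₀⟩ A (G n x)) < min η 1 * ε :=
    (hlim (truncatedModulusBCF ⟨f₀, hf₀⟩ A)).eventually_lt_const
      (lt_of_le_of_lt hA' (by have : 0 < min η 1 * ε := by positivity
                              linarith))
  filter_upwards [hev] with n hn
  refine le_trans (measure_mono ?_) ((measure_ge_le_outerExpectation
    (fun x => truncatedModulus_nonneg ⟨f₀, hf₀⟩ A (G n x))
    (fun x => truncatedModulus_le_one ⟨f₀, hf₀⟩ A (G n x)) hmin).trans
      (ENNReal.ofReal_le_ofReal ?_))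
  · rintro x ⟨f, hf, hfδ, hfη⟩
    refine le_trans ?_ (le_truncatedModulus ⟨f₀, hf₀⟩ (G n x) (f := ⟨f, hf⟩) hfδ)
    rw [hGsub]
    exact min_le_min_right _ hfη.le
  · rw [div_le_iff₀ hmin, mul_comm]
    exact hn.le

end Equicontinuity

/-! ### Random signs -/

section Signs

variable {ι : Type*} [DecidableEq ι]

/-- The sum of `a i` over `s`, with the sign of `a i` positive exactly for `i ∈ A`. -/
def signedSum (s : Finset ι) (a : ι → ℝ) (A : Finset ι) : ℝ :=
  ∑ i ∈ s, if i ∈ A then a i else -a i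

lemma signedSum_insert_of_notMem {s : Finset ι} {i : ι} (hi : i ∉ s) (a : ι → ℝ)
    {A : Finset ι} (hA : A ⊆ s) :
    signedSum (insert i s) a A = signedSum s a A - a i := by
  rw [signedSum, Finset.sum_insert hi, if_neg fun h => hi (hA h), signedSum]
  ring

lemma signedSum_insert_insert {s : Finset ι} {i : ι} (hi : i ∉ s) (a : ι → ℝ)
    (A : Finset ι) :
    signedSum (insert i s) a (insert i A) = signedSum s a A + a i := by
  rw [signedSum, Finset.sum_insert hi, if_pos (Finset.mem_insert_self i A), signedSum, add_comm]
  congr 1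
  refine Finset.sum_congr rfl fun j hj => ?_
  have : j ≠ i := fun h => hi (h ▸ hj)
  simp [this]

/-- Pairing `A` with `insert i A` averages over the sign of `a i` and cancels the cross term. -/
lemma sum_signedSum_sq (s : Finset ι) (a : ι → ℝ) :
    ∑ A ∈ s.powerset, signedSum s a A ^ 2 = 2 ^ s.card * ∑ i ∈ s, a i ^ 2 := by
  induction s using Finset.induction_on with
  | empty => simp [signedSum]
  | insert i s hi ih =>
    rw [Finset.sum_powerset_insert hi, ← Finset.sum_add_distrib, Finset.card_insert_of_notMem hi,
      Finset.sum_insert hi]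
    have : ∀ A ∈ s.powerset, signedSum (insert i s) a A ^ 2 +
        signedSum (insert i s) a (insert i A) ^ 2 = 2 * signedSum s a A ^ 2 + 2 * a i ^ 2 := by
      intro A hA
      rw [signedSum_insert_of_notMem hi a (Finset.mem_powerset.1 hA),
        signedSum_insert_insert hi]
      ring
    rw [Finset.sum_congr rfl this, Finset.sum_add_distrib, ← Finset.mul_sum, ih,
      Finset.sum_const, Finset.card_powerset, nsmul_eq_mul]
    push_cast
    ring

/-- Khinchine's inequality for the fourth moment. The same pairing kills the odd powers, and the
induction step leaves a surplus of `4 · 2 ^ s.card * a i ^ 4`. -/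
lemma sum_signedSum_pow_four_le (s : Finset ι) (a : ι → ℝ) :
    ∑ A ∈ s.powerset, signedSum s a A ^ 4 ≤ 3 * 2 ^ s.card * (∑ i ∈ s, a i ^ 2) ^ 2 := by
  induction s using Finset.induction_on with
  | empty => simp [signedSum]
  | insert i s hi ih =>
    rw [Finset.sum_powerset_insert hi, ← Finset.sum_add_distrib, Finset.card_insert_of_notMem hi,
      Finset.sum_insert hi]
    have : ∀ A ∈ s.powerset, signedSum (insert i s) a A ^ 4 +
        signedSum (insert i s) a (insert i A) ^ 4 =
          2 * signedSum s a A ^ 4 + 12 * a i ^ 2 * signedSum s a A ^ 2 + 2 * a i ^ 4 := by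
      intro A hA
      rw [signedSum_insert_of_notMem hi a (Finset.mem_powerset.1 hA),
        signedSum_insert_insert hi]
      ring
    rw [Finset.sum_congr rfl this, Finset.sum_add_distrib, Finset.sum_add_distrib,
      ← Finset.mul_sum, ← Finset.mul_sum, sum_signedSum_sq,
      Finset.sum_const, Finset.card_powerset, nsmul_eq_mul]
    push_cast
    have h0 : (0 : ℝ) ≤ 2 ^ s.card * a i ^ 4 := by positivity
    set v := ∑ i ∈ s, a i ^ 2
    have : 3 * 2 ^ (s.card + 1) * (a i ^ 2 + v) ^ 2 - (2 * (3 * 2 ^ s.card * v ^ 2) +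
      12 * a i ^ 2 * (2 ^ s.card * v) + 2 ^ s.card * (2 * a i ^ 4)) =
        4 * (2 ^ s.card * a i ^ 4) := by ring
    linarith

/-- At least a fraction `3/16` of the choices of signs gives `S² > v / 4`, where `v = ∑ aᵢ²`. -/
lemma card_signedSum_sq_gt {s : Finset ι} {a : ι → ℝ} (ha : 0 < ∑ i ∈ s, a i ^ 2) :
    (3 : ℝ) * 2 ^ s.card ≤
      16 * (s.powerset.filter fun A => (∑ i ∈ s, a i ^ 2) / 4 < signedSum s a A ^ 2).card := by
  set v := ∑ i ∈ s, a i ^ 2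
  set N : ℝ := 2 ^ s.card with hN
  have hNpos : 0 < N := by positivity
  set B := s.powerset.filter fun A => v / 4 < signedSum s a A ^ 2 with hB
  -- Paley–Zygmund: patterns outside `B` carry at most a quarter of the second moment, and
  -- Cauchy–Schwarz with the fourth moment bounds the rest. The fraction is `(3/4)² / 3 = 3/16`.
  have h1 : N * v ≤ N * (v / 4) + ∑ A ∈ B, signedSum s a A ^ 2 := by
    rw [← sum_signedSum_sq s a, ← Finset.sum_filter_add_sum_filter_not s.powerset
      (fun A => v / 4 < signedSum s a A ^ 2), add_comm]
    gcongr
    calc ∑ A ∈ s.powerset with ¬ v / 4 < signedSum s a A ^ 2, signedSum s a A ^ 2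
        ≤ ∑ A ∈ s.powerset with ¬ v / 4 < signedSum s a A ^ 2, v / 4 :=
          Finset.sum_le_sum fun A hA => not_lt.1 (Finset.mem_filter.1 hA).2
      _ ≤ ∑ A ∈ s.powerset, v / 4 :=
          Finset.sum_le_sum_of_subset_of_nonneg (Finset.filter_subset _ _)
            fun _ _ _ => by positivity
      _ = N * (v / 4) := by simp [hN]
  have h2 : (∑ A ∈ B, signedSum s a A ^ 2) ^ 2 ≤ B.card * (3 * N * v ^ 2) := by
    refine sq_sum_le_card_mul_sum_sq.trans ?_
    gcongr
    calc ∑ A ∈ B, (signedSum s a A ^ 2) ^ 2 = ∑ A ∈ B, signedSum s a A ^ 4 := by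
          simp_rw [← pow_mul]
      _ ≤ ∑ A ∈ s.powerset, signedSum s a A ^ 4 :=
          Finset.sum_le_sum_of_subset_of_nonneg (Finset.filter_subset _ _)
            fun _ _ _ => by positivity
      _ ≤ _ := sum_signedSum_pow_four_le s a
  have h3 : (3 / 4 * (N * v)) ^ 2 ≤ (∑ A ∈ B, signedSum s a A ^ 2) ^ 2 := by
    gcongr
    linarith
  have h4 : N * v ^ 2 * (9 * N) ≤ N * v ^ 2 * (48 * B.card) := by
    have := h3.trans h2
    nlinarith
  have h5 := le_of_mul_le_mul_left h4 (by positivity)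
  linarith

lemma signedSum_eq_sub {s A : Finset ι} (a : ι → ℝ) (hA : A ⊆ s) :
    signedSum s a A = ∑ i ∈ A, a i - ∑ i ∈ s \ A, a i := by
  rw [signedSum, ← Finset.sum_sdiff hA, add_comm, sub_eq_add_neg, ← Finset.sum_neg_distrib]
  congr 1
  · exact Finset.sum_congr rfl fun i hi => if_pos hi
  · exact Finset.sum_congr rfl fun i hi => if_neg (Finset.mem_sdiff.1 hi).2

/-- Chebyshev's inequality for the imbalance of the signs. -/
lemma card_signedSum_one_sq_gt (s : Finset ι) :
    16 * ((s.powerset.filter fun A => 16 * (s.card : ℝ) < signedSum s (fun _ => 1) A ^ 2).card : ℝ)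
      ≤ 2 ^ s.card := by
  rcases s.eq_empty_or_nonempty with rfl | hs
  · simp [signedSum]
  have hc : (0 : ℝ) < s.card := by exact_mod_cast hs.card_pos
  set B := s.powerset.filter fun A => 16 * (s.card : ℝ) < signedSum s (fun _ => 1) A ^ 2
  have h : ∑ A ∈ B, 16 * (s.card : ℝ) ≤ 2 ^ s.card * s.card := by
    calc ∑ A ∈ B, 16 * (s.card : ℝ) ≤ ∑ A ∈ B, signedSum s (fun _ => 1) A ^ 2 :=
          Finset.sum_le_sum fun A hA => (Finset.mem_filter.1 hA).2.le
      _ ≤ ∑ A ∈ s.powerset, signedSum s (fun _ => 1) A ^ 2 :=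
          Finset.sum_le_sum_of_subset_of_nonneg (Finset.filter_subset _ _)
            fun _ _ _ => by positivity
      _ = 2 ^ s.card * s.card := by rw [sum_signedSum_sq]; simp
  rw [Finset.sum_const, nsmul_eq_mul] at h
  refine le_of_mul_le_mul_right ?_ hc
  linarith

end Signs

/-! ### Second moments over a Donsker class -/

section Symmetrization

variable {𝒳 : Type*} [MeasurableSpace 𝒳] {P : Measure 𝒳}

lemma measurePreserving_of_iIndepFun {S ι : Type*} [MeasurableSpace S] [Fintype ι]
    {μ : Measure S} {Y : ι → S → 𝒳} (hY : iIndepFun Y μ)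
    (hl : ∀ i, MeasurePreserving (Y i) μ P) :
    MeasurePreserving (fun ω i => Y i ω) μ (Measure.pi fun _ => P) := by
  refine ⟨measurable_pi_lambda _ fun i => (hl i).measurable, ?_⟩
  rw [hY.map_fun_eq_pi_map fun i => (hl i).measurable.aemeasurable]
  simp_rw [(hl _).map_eq]

variable [IsProbabilityMeasure P]

lemma measurePreserving_comp_injective {m n : ℕ} {e : Fin m → Fin n}
    (he : Function.Injective e) :
    MeasurePreserving (fun (x : Fin n → 𝒳) i => x (e i)) (Measure.pi fun _ => P)
      (Measure.pi fun _ => P) := by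
  have h : iIndepFun (fun (i : Fin n) (x : Fin n → 𝒳) => x i) (Measure.pi fun _ => P) :=
    iIndepFun_pi (X := fun _ y => y) fun _ => aemeasurable_id
  exact measurePreserving_of_iIndepFun (Y := fun i (x : Fin n → 𝒳) => x (e i)) (h.precomp he)
    fun i => measurePreserving_eval _ (e i)

/-- The event that a partial sum of centred functions in `H` over `A` exceeds `η √|A|`. -/
def largePartialSum (P : Measure 𝒳) (H : Set (𝒳 → ℝ)) (η : ℝ) {n : ℕ} (A : Finset (Fin n)) :
    Set (Fin n → 𝒳) :=
  {x | ∃ h ∈ H, η * Real.sqrt A.card < |∑ i ∈ A, (h (x i) - ∫ y, h y ∂P)|}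

/-- The coordinates in `A`, listed in increasing order, form an independent sample of size `A.card`.
The events may be nonmeasurable, so outer measures are only compared by an inequality. -/
lemma measure_largePartialSum_le (H : Set (𝒳 → ℝ)) (η : ℝ) {n : ℕ} (A : Finset (Fin n)) :
    (Measure.pi fun _ => P) (largePartialSum P H η A) ≤
      (Measure.pi fun _ : Fin A.card => P) {x | ∃ h ∈ H, η < |(empiricalProcess P A.card x h)|} := by
  set e := A.orderEmbOfFin rfl
  have he : MeasurePreserving (fun (x : Fin n → 𝒳) i => x (e i)) (Measure.pi fun _ => P)
      (Measure.pi fun _ : Fin A.card => P) := measurePreserving_comp_injective e.injective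
  rw [← he.map_eq]
  refine le_trans (measure_mono ?_) (Measure.le_map_apply he.aemeasurable _)
  rintro x ⟨h, hh, hx⟩
  refine ⟨h, hh, ?_⟩
  have hsum : ∑ i ∈ A, (h (x i) - ∫ y, h y ∂P) = ∑ i, (h (x (e i)) - ∫ y, h y ∂P) := by
    conv_lhs => rw [← Finset.map_orderEmbOfFin_univ A rfl]
    exact Finset.sum_map _ _ _
  rw [hsum] at hx
  rw [empiricalProcess_eq_sum, abs_mul, abs_of_nonneg (inv_nonneg.2 (Real.sqrt_nonneg _))]
  have hpos : 0 < Real.sqrt A.card := by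
    rcases Nat.eq_zero_or_pos A.card with h0 | h0
    · exfalso
      have : A = ∅ := Finset.card_eq_zero.1 h0
      rw [← hsum, this] at hx
      simp at hx
    · exact Real.sqrt_pos.2 (by exact_mod_cast h0)
  rwa [inv_mul_eq_div, lt_div_iff₀ hpos]

/-- Symmetrization: if the empirical process over `H` is small for all large sample sizes, then so
are the empirical second moments over `H`. -/
lemma measure_second_moment_gt_le {H : Set (𝒳 → ℝ)} {η : ℝ} (hη : 0 < η) {ε : ℝ≥0∞} {n : ℕ}
    (hn : 64 ≤ n)
    (hp : ∀ m, n ≤ 4 * m → (Measure.pi fun _ : Fin m => P)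
      {x | ∃ h ∈ H, η < |(empiricalProcess P m x h)|} ≤ ε)
    (hmean : ∀ h ∈ H, |∫ y, h y ∂P| ≤ η / 4) :
    (Measure.pi fun _ : Fin n => P) {x | ∃ h ∈ H, 36 * η ^ 2 < (n : ℝ)⁻¹ * ∑ i, h (x i) ^ 2}
      ≤ 16 * ε := by
  classical
  have hn' : (64 : ℝ) ≤ n := by exact_mod_cast hn
  set μ : Measure (Fin n → 𝒳) := Measure.pi fun _ => P
  set good : Finset (Finset (Fin n)) := Finset.univ.powerset.filter
    fun A => ¬ 16 * ((Finset.univ : Finset (Fin n)).card : ℝ)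
      < signedSum Finset.univ (fun _ => 1) A ^ 2 with hgood
  set E : Finset (Fin n) → Set (Fin n → 𝒳) :=
    fun A => largePartialSum P H η A ∪ largePartialSum P H η Aᶜ
  have hcard : ∀ A : Finset (Fin n), (A.card : ℝ) + (Aᶜ.card : ℝ) = n := fun A => by
    have := A.card_add_card_compl
    rw [Fintype.card_fin] at this
    exact_mod_cast this
  have hone : ∀ A : Finset (Fin n), signedSum Finset.univ (fun _ => 1) A
      = A.card - (Aᶜ.card : ℝ) := fun A => by
    rw [signedSum_eq_sub _ (Finset.subset_univ A), ← Finset.compl_eq_univ_sdiff]; simp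
  -- A good pattern has imbalance at most `4√n`, which is at most `n/2` once `n ≥ 64`. Both
  -- subsamples then have size at least `n/4`, as `hp` requires.
  have hE : ∀ A ∈ good, μ (E A) ≤ 2 * ε := by
    intro A hA
    have h1 : ((A.card : ℝ) - Aᶜ.card) ^ 2 ≤ 16 * n := by
      have := not_lt.1 (Finset.mem_filter.1 hA).2
      rw [hone] at this
      simpa using this
    have h2 : |(A.card : ℝ) - Aᶜ.card| ≤ n / 2 := by
      refine abs_le_of_sq_le_sq ?_ (by positivity)
      nlinarith
    have h3 := hcard A
    rw [abs_le] at h2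
    have h4 : n ≤ 4 * A.card := by
      have : (n : ℝ) ≤ 4 * A.card := by linarith [h2.1]
      exact_mod_cast this
    have h5 : n ≤ 4 * Aᶜ.card := by
      have : (n : ℝ) ≤ 4 * Aᶜ.card := by linarith [h2.2]
      exact_mod_cast this
    rw [two_mul]
    exact (measure_union_le _ _).trans (add_le_add
      ((measure_largePartialSum_le H η A).trans (hp _ h4))
      ((measure_largePartialSum_le H η Aᶜ).trans (hp _ h5)))
  -- At least `3/16` of the patterns give a large signed sum and at most `1/16` are unbalanced,
  -- leaving `1/8` that are good with `x ∈ E A`.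
  have hkey : ∀ x ∈ {x : Fin n → 𝒳 | ∃ h ∈ H, 36 * η ^ 2 < (n : ℝ)⁻¹ * ∑ i, h (x i) ^ 2},
      2 ^ n ≤ 8 * (good.filter fun A => x ∈ E A).card := by
    rintro x ⟨h, hh, hx⟩
    have hv : 36 * η ^ 2 * n < ∑ i, h (x i) ^ 2 := by
      rwa [inv_mul_eq_div, lt_div_iff₀ (by linarith)] at hx
    have h1 := card_signedSum_sq_gt (s := (Finset.univ : Finset (Fin n)))
      (a := fun i => h (x i))
      (lt_of_le_of_lt (by positivity) hv)
    have h2 := card_signedSum_one_sq_gt (Finset.univ : Finset (Fin n))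
    set B := (Finset.univ : Finset (Fin n)).powerset.filter fun A =>
      (∑ i, h (x i) ^ 2) / 4 < signedSum Finset.univ (fun i => h (x i)) A ^ 2
    set bad := (Finset.univ : Finset (Fin n)).powerset.filter fun A =>
      16 * ((Finset.univ : Finset (Fin n)).card : ℝ) < signedSum Finset.univ (fun _ => 1) A ^ 2
    have hsub : B ⊆ (good.filter fun A => x ∈ E A) ∪ bad := by
      intro A hA
      by_cases hb : A ∈ bad
      · exact Finset.mem_union_right _ hb
      have hAg : A ∈ good := by
        refine Finset.mem_filter.2 ⟨by simp, fun hlt => hb (Finset.mem_filter.2 ⟨by simp, hlt⟩)⟩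
      refine Finset.mem_union_left _ (Finset.mem_filter.2 ⟨hAg, ?_⟩)
      have hS := (Finset.mem_filter.1 hA).2
      have h3 : ((A.card : ℝ) - Aᶜ.card) ^ 2 ≤ 16 * n := by
        have := not_lt.1 (Finset.mem_filter.1 hAg).2
        rw [hone] at this
        simpa using this
      set q := ∫ y, h y ∂P
      set s1 := ∑ i ∈ A, (h (x i) - q) with hs1
      set s2 := ∑ i ∈ Aᶜ, (h (x i) - q) with hs2
      have hdec : signedSum Finset.univ (fun i => h (x i)) A
          = s1 - s2 + (A.card - (Aᶜ.card : ℝ)) * q := by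
        rw [signedSum_eq_sub _ (Finset.subset_univ A), ← Finset.compl_eq_univ_sdiff, hs1, hs2]
        simp only [Finset.sum_sub_distrib, Finset.sum_const, nsmul_eq_mul]
        ring
      set w := Real.sqrt n with hw
      have hw0 : 0 ≤ w := Real.sqrt_nonneg _
      have hw2 : w ^ 2 = n := Real.sq_sqrt (by positivity)
      -- The signed sum exceeds `3η√n` because `36/4 = 3²`. The mean contributes at most `4√n ·
      -- η/4`, so one of the centred subsample sums must exceed `η√n`.
      have h4 : 3 * (η * w) < |signedSum Finset.univ (fun i => h (x i)) A| := by
        refine lt_of_pow_lt_pow_left₀ 2 (abs_nonneg _) ?_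
        rw [sq_abs]
        have : (3 * (η * w)) ^ 2 = 36 * η ^ 2 * n / 4 := by rw [mul_pow, mul_pow, hw2]; ring
        rw [this]
        linarith
      have h5 : |(A.card - (Aᶜ.card : ℝ)) * q| ≤ η * w := by
        refine abs_le_of_sq_le_sq ?_ (by positivity)
        have hq : q ^ 2 ≤ (η / 4) ^ 2 := by
          rw [← sq_abs]; exact pow_le_pow_left₀ (abs_nonneg _) (hmean h hh) 2
        calc ((A.card - (Aᶜ.card : ℝ)) * q) ^ 2 = (A.card - (Aᶜ.card : ℝ)) ^ 2 * q ^ 2 := by ring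
          _ ≤ 16 * n * (η / 4) ^ 2 := by gcongr
          _ = (η * w) ^ 2 := by rw [mul_pow, hw2]; ring
      have h6 : 3 * (η * w) < |s1| + |s2| + η * w := by
        rw [hdec] at h4
        have := abs_add_le (s1 - s2) ((A.card - (Aᶜ.card : ℝ)) * q)
        have := abs_sub s1 s2
        linarith
      have hle : ∀ B : Finset (Fin n), η * Real.sqrt B.card ≤ η * w := by
        intro B
        refine mul_le_mul_of_nonneg_left (Real.sqrt_le_sqrt ?_) hη.le
        exact_mod_cast B.card_le_univ.trans_eq (Fintype.card_fin n)
      rcases lt_or_ge (η * w) |s1| with h7 | h7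
      · exact Or.inl ⟨h, hh, (hle A).trans_lt h7⟩
      · exact Or.inr ⟨h, hh, (hle Aᶜ).trans_lt (by linarith)⟩
    have h3 : (B.card : ℝ) ≤ (good.filter fun A => x ∈ E A).card + bad.card := by
      exact_mod_cast (Finset.card_le_card hsub).trans (Finset.card_union_le _ _)
    have h4 : (2 : ℝ) ^ n ≤ 8 * (good.filter fun A => x ∈ E A).card := by
      simp only [Finset.card_univ, Fintype.card_fin] at h1 h2
      linarith
    exact_mod_cast h4
  -- Double counting over pairs of sample and pattern: Markov's inequality for the number of
  -- patterns with `x ∈ E A`, each event replaced by a measurable hull.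
  set f : (Fin n → 𝒳) → ℝ≥0∞ :=
    fun x => 8 * ∑ A ∈ good, (toMeasurable μ (E A)).indicator (fun _ => 1) x with hf
  have hfm : Measurable f := by
    refine Measurable.const_mul (Finset.measurable_fun_sum _ fun A _ => ?_) _
    exact measurable_const.indicator (measurableSet_toMeasurable _ _)
  have hfl : ∫⁻ x, f x ∂μ ≤ 2 ^ n * (16 * ε) := by
    rw [lintegral_const_mul _ (Finset.measurable_fun_sum _ fun A _ =>
      measurable_const.indicator (measurableSet_toMeasurable _ _)),
      lintegral_finsetSum _ fun A _ => measurable_const.indicator (measurableSet_toMeasurable _ _)]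
    calc 8 * ∑ A ∈ good, ∫⁻ x, (toMeasurable μ (E A)).indicator (fun _ => 1) x ∂μ
        = 8 * ∑ A ∈ good, μ (E A) := by
          congr 1
          refine Finset.sum_congr rfl fun A _ => ?_
          rw [lintegral_indicator (measurableSet_toMeasurable _ _)]
          simp
      _ ≤ 8 * ∑ A ∈ good, 2 * ε := by gcongr with A hA; exact hE A hA
      _ ≤ 8 * ∑ A ∈ (Finset.univ : Finset (Finset (Fin n))), 2 * ε := by
          gcongr; exact Finset.subset_univ _
      _ = 2 ^ n * (16 * ε) := by
          simp only [Finset.sum_const, Finset.card_univ, Fintype.card_finset, Fintype.card_fin,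
            nsmul_eq_mul]
          push_cast
          ring
  have hmarkov := (mul_meas_ge_le_lintegral hfm (2 ^ n)).trans hfl
  rw [ENNReal.mul_le_mul_iff_right (by simp) (by simp)] at hmarkov
  refine (measure_mono fun x hx => ?_).trans hmarkov
  have h1 : ((2 ^ n : ℕ) : ℝ≥0∞) ≤ ((8 * (good.filter fun A => x ∈ E A).card : ℕ) : ℝ≥0∞) := by
    exact_mod_cast hkey x hx
  push_cast at h1
  refine h1.trans ?_
  refine mul_le_mul_right ?_ 8
  rw [Finset.card_filter]
  push_cast
  refine Finset.sum_le_sum fun A _ => ?_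
  split_ifs with hA
  · rw [Set.indicator_of_mem (subset_toMeasurable _ _ hA)]
  · exact zero_le

/-- Empirical second moments of increments of a Donsker class are asymptotically small over
`L²`-small increments. -/
lemma IsDonsker.second_moment_small {F : Set (𝒳 → ℝ)} (hF : IsDonsker P F) {f₀ : 𝒳 → ℝ}
    (hf₀ : f₀ ∈ F) {η ε : ℝ} (hη : 0 < η) (hε : 0 < ε) :
    ∃ δ > 0, ∀ᶠ n in atTop, (Measure.pi fun _ : Fin n => P)
      {x | ∃ f ∈ F, ∫ y, (f y - f₀ y) ^ 2 ∂P ≤ δ ^ 2 ∧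
        η < (n : ℝ)⁻¹ * ∑ i, (f (x i) - f₀ (x i)) ^ 2} ≤ ENNReal.ofReal ε := by
  set κ := Real.sqrt η / 6 with hκ
  have hκ0 : 0 < κ := by positivity
  have hκ2 : 36 * κ ^ 2 = η := by rw [hκ, div_pow, Real.sq_sqrt hη.le]; ring
  obtain ⟨δ, hδ, hev⟩ := hF.asymptotic_equicontinuity hf₀ hκ0 (ε := ε / 16) (by positivity)
  obtain ⟨N, hN⟩ := eventually_atTop.1 hev
  -- The bound `κ / 4` on the `L²` distance also bounds the mean of each increment, as
  -- symmetrization requires.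
  refine ⟨min δ (κ / 4), by positivity, ?_⟩
  filter_upwards [eventually_ge_atTop (max 64 (4 * N))] with n hn
  set H : Set (𝒳 → ℝ) :=
    {h | ∃ f ∈ F, ∫ y, (f y - f₀ y) ^ 2 ∂P ≤ min δ (κ / 4) ^ 2 ∧ h = f - f₀} with hH
  have hmin : 0 < min δ (κ / 4) := by positivity
  have hmain := measure_second_moment_gt_le (P := P) (H := H) hκ0
    (ε := ENNReal.ofReal (ε / 16)) ((le_max_left _ _).trans hn) ?_ ?_
  · refine (measure_mono ?_).trans (hmain.trans ?_)
    · rintro x ⟨f, hf, hfδ, hfη⟩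
      exact ⟨f - f₀, ⟨f, hf, hfδ, rfl⟩, by rw [hκ2]; simpa using hfη⟩
    · rw [show (16 : ℝ≥0∞) = ENNReal.ofReal 16 by simp, ← ENNReal.ofReal_mul (by norm_num)]
      exact ENNReal.ofReal_le_ofReal (by linarith)
  · intro m hm
    refine (measure_mono ?_).trans (hN m ?_)
    · rintro x ⟨_, ⟨f, hf, hfδ, rfl⟩, hx⟩
      exact ⟨f, hf, hfδ.trans (pow_le_pow_left₀ hmin.le (min_le_left _ _) 2), hx⟩
    · have := (le_max_right _ _).trans hn
      omega
  · rintro _ ⟨f, hf, hfδ, rfl⟩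
    have hL : MemLp (f - f₀) 2 P := (hF.1 f hf).2.sub (hF.1 f₀ hf₀).2
    have hvar := variance_nonneg (f - f₀) P
    rw [variance_eq_sub hL] at hvar
    refine (abs_le_of_sq_le_sq ?_ hmin.le).trans (min_le_right _ _)
    have : P[(f - f₀) ^ 2] = ∫ y, (f y - f₀ y) ^ 2 ∂P := by simp
    rw [this] at hvar
    linarith

end Symmetrization

/-! ### Uniform convergence to zero in outer probability -/

section UniformlySmall

variable {S Θ : Type*} [MeasurableSpace S] {Pr : Measure S} {N : ℕ → Set Θ}

/-- `sup_{θ ∈ N n} D n θ` is at most `o(1)` in outer probability. -/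
def UniformlySmall (Pr : Measure S) (N : ℕ → Set Θ) (D : ℕ → S → Θ → ℝ) : Prop :=
  ∀ η : ℝ, 0 < η → Tendsto (fun n => Pr {ω | ∃ θ ∈ N n, η < D n ω θ}) atTop (𝓝 0)

/-- Reduces a stochastic claim to a deterministic implication, valid for all large `n` and every
outcome, via a union bound over finitely many error terms. -/
lemma UniformlySmall.of_finite {ι : Type*} [Fintype ι] {D : ι → ℕ → S → Θ → ℝ}
    (h : ∀ j, UniformlySmall Pr N (D j)) {D' : ℕ → S → Θ → ℝ}
    (hD : ∀ ε > 0, ∃ η > 0, ∀ᶠ n in atTop, ∀ ω, (∀ θ ∈ N n, ∀ j, D j n ω θ ≤ η) →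
      ∀ θ ∈ N n, D' n ω θ ≤ ε) : UniformlySmall Pr N D' := by
  intro ε hε
  obtain ⟨η, hη, hev⟩ := hD ε hε
  have hsum : Tendsto (fun n => ∑ j, Pr {ω | ∃ θ ∈ N n, η < D j n ω θ}) atTop (𝓝 0) := by
    simpa using tendsto_finsetSum Finset.univ fun j _ => h j η hη
  refine tendsto_of_tendsto_of_tendsto_of_le_of_le' tendsto_const_nhds hsum
    (Eventually.of_forall fun _ => zero_le) ?_
  filter_upwards [hev] with n hn
  refine (measure_mono ?_).trans (measure_iUnion_fintype_le Pr _)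
  rintro ω ⟨θ, hθ, hlt⟩
  by_contra hcon
  simp only [Set.mem_iUnion, Set.mem_ofPred_eq, not_exists, not_and, not_lt] at hcon
  exact absurd (hn ω (fun θ hθ j => hcon j θ hθ) θ hθ) (not_le.2 hlt)

lemma UniformlySmall.sumElim {ι κ : Type*} {D : ι → ℕ → S → Θ → ℝ} {E : κ → ℕ → S → Θ → ℝ}
    (hD : ∀ j, UniformlySmall Pr N (D j)) (hE : ∀ j, UniformlySmall Pr N (E j)) :
    ∀ j, UniformlySmall Pr N (Sum.elim D E j) := by
  rintro (j | j)
  exacts [hD j, hE j]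

lemma UniformlySmall.of_eventually_le {D : ℕ → S → Θ → ℝ}
    (h : ∀ η > 0, ∀ ε > 0, ∀ᶠ n in atTop,
      Pr {ω | ∃ θ ∈ N n, η < D n ω θ} ≤ ENNReal.ofReal ε) : UniformlySmall Pr N D := by
  intro η hη
  rw [ENNReal.tendsto_nhds_zero]
  intro ε hε
  rcases eq_or_ne ε ∞ with rfl | hε'
  · simp
  · have := h η hη ε.toReal (ENNReal.toReal_pos hε.ne' hε')
    rwa [ENNReal.ofReal_toReal hε'] at this

/-- When `B` is bounded in probability, it suffices to work on the events `B ≤ M`; the rest has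
probability at most `ε / 2` for suitable `M`. -/
lemma UniformlySmall.of_forall_truncation {D : ℕ → S → Θ → ℝ} {B : ℕ → S → ℝ}
    (hB : ∀ ε > 0, ∃ M, ∀ n, Pr {ω | M < B n ω} ≤ ENNReal.ofReal ε)
    (h : ∀ M, UniformlySmall Pr N fun n ω θ => if B n ω ≤ M then D n ω θ else 0) :
    UniformlySmall Pr N D := by
  refine .of_eventually_le fun η hη ε hε => ?_
  obtain ⟨M, hM⟩ := hB (ε / 2) (by positivity)
  have := (ENNReal.tendsto_nhds_zero.1 (h M η hη)) (ENNReal.ofReal (ε / 2)) (by simpa using hε)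
  filter_upwards [this] with n hn
  calc Pr {ω | ∃ θ ∈ N n, η < D n ω θ}
      ≤ Pr ({ω | ∃ θ ∈ N n, η < if B n ω ≤ M then D n ω θ else 0} ∪ {ω | M < B n ω}) := by
        refine measure_mono ?_
        rintro ω ⟨θ, hθ, hlt⟩
        rcases le_or_gt (B n ω) M with hle | hgt
        · exact Or.inl ⟨θ, hθ, by rwa [if_pos hle]⟩
        · exact Or.inr hgt
    _ ≤ ENNReal.ofReal (ε / 2) + ENNReal.ofReal (ε / 2) :=
        (measure_union_le _ _).trans (add_le_add hn (hM n))
    _ = ENNReal.ofReal ε := by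
        rw [← ENNReal.ofReal_add (by positivity) (by positivity), add_halves]

lemma UniformlySmall.of_tendstoInMeasure {f : ℕ → S → ℝ} {c : ℝ}
    (h : TendstoInMeasure Pr f atTop fun _ => c) :
    UniformlySmall Pr N fun n ω _ => |f n ω - c| := by
  intro η hη
  refine tendsto_of_tendsto_of_tendsto_of_le_of_le tendsto_const_nhds
    (h (ENNReal.ofReal η) (by simpa using hη)) (fun _ => zero_le) fun n => ?_
  refine measure_mono ?_
  rintro ω ⟨_, _, hlt⟩
  rw [Set.mem_ofPred_eq, edist_dist, Real.dist_eq]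
  exact ENNReal.ofReal_le_ofReal hlt.le

end UniformlySmall

/-! ### Coordinates of the moment functions -/

section Coordinates

variable {𝒳 Θ : Type*} [MeasurableSpace 𝒳] {P₀ : Measure 𝒳} {k : ℕ}

lemma integral_apply_coord {f : 𝒳 → EuclideanSpace ℝ (Fin k)} (hf : Integrable f P₀) (j : Fin k) :
    (∫ y, f y ∂P₀) j = ∫ y, f y j ∂P₀ :=
  ((EuclideanSpace.proj (𝕜 := ℝ) j).integral_comp_comm hf).symm

lemma sum_apply_coord {n : ℕ} (f : Fin n → EuclideanSpace ℝ (Fin k)) (j : Fin k) :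
    (∑ i, f i) j = ∑ i, f i j :=
  map_sum (EuclideanSpace.proj (𝕜 := ℝ) j) f Finset.univ

lemma empiricalProcess_apply_coord {f : 𝒳 → EuclideanSpace ℝ (Fin k)} (hf : Integrable f P₀)
    {n : ℕ} (x : Fin n → 𝒳) (j : Fin k) :
    empiricalProcess P₀ n x f j = empiricalProcess P₀ n x fun y => f y j := by
  simp [empiricalProcess, integral_apply_coord hf, sum_apply_coord]

omit [MeasurableSpace 𝒳] in
lemma sampleMoment_apply_coord (ρ : Θ → 𝒳 → EuclideanSpace ℝ (Fin k)) {n : ℕ} (x : Fin n → 𝒳)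
    (θ : Θ) (j : Fin k) : sampleMoment ρ n x θ j = (n : ℝ)⁻¹ * ∑ i, ρ θ (x i) j := by
  simp [sampleMoment, sum_apply_coord]

lemma norm_le_sum_abs (v : EuclideanSpace ℝ (Fin k)) : ‖v‖ ≤ ∑ j, |v j| := by
  rw [EuclideanSpace.norm_eq]
  refine Real.sqrt_le_iff.2 ⟨Finset.sum_nonneg fun _ _ => abs_nonneg _, ?_⟩
  simp only [Real.norm_eq_abs]
  exact Finset.sum_sq_le_sq_sum_of_nonneg fun _ _ => abs_nonneg _

lemma norm_le_of_forall_abs_le {v : EuclideanSpace ℝ (Fin k)} {η : ℝ} (hη : 0 ≤ η)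
    (h : ∀ j, |v j| ≤ η / (k + 1)) : ‖v‖ ≤ η := by
  refine (norm_le_sum_abs v).trans ((Finset.sum_le_sum fun j _ => h j).trans ?_)
  rw [Finset.sum_const, Finset.card_univ, Fintype.card_fin, nsmul_eq_mul, ← mul_div_assoc,
    div_le_iff₀ (by positivity)]
  nlinarith

lemma sq_apply_le_norm_sq (v : EuclideanSpace ℝ (Fin k)) (j : Fin k) : v j ^ 2 ≤ ‖v‖ ^ 2 := by
  rw [← sq_abs, ← Real.norm_eq_abs]
  exact pow_le_pow_left₀ (norm_nonneg _) (PiLp.norm_apply_le v j) 2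

lemma integral_coord_sq_le {f : 𝒳 → EuclideanSpace ℝ (Fin k)} (hf : Measurable f) {c : ℝ}
    (hc : 0 ≤ c) (h : ∫⁻ y, ‖f y‖ₑ ^ 2 ∂P₀ ≤ ENNReal.ofReal c) (j : Fin k) :
    ∫ y, f y j ^ 2 ∂P₀ ≤ c := by
  have hm : Measurable fun y => f y j ^ 2 := by fun_prop
  rw [integral_eq_lintegral_of_nonneg_ae (Eventually.of_forall fun _ => sq_nonneg _)
    hm.aestronglyMeasurable]
  refine ENNReal.toReal_le_of_le_ofReal hc (le_trans (lintegral_mono fun y => ?_) h)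
  rw [← ofReal_norm, ← ENNReal.ofReal_pow (norm_nonneg _)]
  exact ENNReal.ofReal_le_ofReal (sq_apply_le_norm_sq _ j)

end Coordinates

/-! ### Local behaviour of the sample moments -/

section Local

variable {S 𝒳 Θ : Type*} [MeasurableSpace S] [MeasurableSpace 𝒳] {Pr : Measure S}
  {P₀ : Measure 𝒳} [IsProbabilityMeasure P₀] {X : ℕ → S → 𝒳} {k : ℕ}
  {ρ : Θ → 𝒳 → EuclideanSpace ℝ (Fin k)} {θstar : Θ} {N : ℕ → Set Θ}

omit [IsProbabilityMeasure P₀] in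
lemma IsIIDSample.measurePreserving_sample (hX : IsIIDSample Pr P₀ X) (n : ℕ) :
    MeasurePreserving (sample X n) Pr (Measure.pi fun _ => P₀) :=
  measurePreserving_of_iIndepFun (Y := fun (i : Fin n) => X i)
    (hX.indep.precomp Fin.val_injective) fun i => hX.law i

omit [IsProbabilityMeasure P₀] in
lemma IsIIDSample.measure_sample_le (hX : IsIIDSample Pr P₀ X) {n : ℕ} {A : Set (Fin n → 𝒳)}
    {B : Set S} (h : ∀ ω ∈ B, sample X n ω ∈ A) : Pr B ≤ (Measure.pi fun _ => P₀) A := by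
  rw [← (hX.measurePreserving_sample n).map_eq]
  exact (measure_mono h).trans
    (Measure.le_map_apply (hX.measurePreserving_sample n).aemeasurable _)

/-- Along `N`, the moment functions approach `ρ_θ*` in `L²`. -/
def L2Shrinking (P₀ : Measure 𝒳) (ρ : Θ → 𝒳 → EuclideanSpace ℝ (Fin k)) (θstar : Θ)
    (N : ℕ → Set Θ) : Prop :=
  ∀ δ > 0, ∀ᶠ n in atTop, ∀ θ ∈ N n, ∀ j, ∫ y, (ρ θ y j - ρ θstar y j) ^ 2 ∂P₀ ≤ δ ^ 2

omit [IsProbabilityMeasure P₀] in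
lemma l2Shrinking_of_tendsto (hρ : ∀ θ, Measurable (ρ θ))
    (hc : Tendsto (fun ε : ℝ => ⨆ θ ∈ enlargement P₀ ρ ε,
      ∫⁻ y, ‖ρ θ y - ρ θstar y‖ₑ ^ 2 ∂P₀) (𝓝[>] 0) (𝓝 0)) {e : ℕ → ℝ}
    (he : Tendsto e atTop (𝓝[>] 0)) :
    L2Shrinking P₀ ρ θstar fun n => enlargement P₀ ρ (e n) := by
  intro δ hδ
  have h := (ENNReal.tendsto_nhds_zero.1 (hc.comp he)) (ENNReal.ofReal (δ ^ 2))
    (by simpa using by positivity)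
  filter_upwards [h] with n hn θ hθ j
  have h2 : ∫⁻ y, ‖ρ θ y - ρ θstar y‖ₑ ^ 2 ∂P₀ ≤ ENNReal.ofReal (δ ^ 2) :=
    (le_iSup₂ (f := fun θ (_ : θ ∈ enlargement P₀ ρ (e n)) =>
      ∫⁻ y, ‖ρ θ y - ρ θstar y‖ₑ ^ 2 ∂P₀) θ hθ).trans hn
  have := integral_coord_sq_le (f := fun y => ρ θ y - ρ θstar y) ((hρ θ).sub (hρ θstar))
    (by positivity) h2 j
  simpa using this

variable {Θ₀ : Set Θ}

/-- Equicontinuity applies to each coordinate, since the `L²` distance to `ρ_θ*` falls below any `δ`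
along `N`; the finitely many coordinates are then combined. -/
lemma uniformlySmall_empiricalProcess_sub (hX : IsIIDSample Pr P₀ X)
    (hρ_int : ∀ θ, Integrable (ρ θ) P₀)
    (hD : IsDonsker P₀ (momentClass ρ Θ₀)) (hstar : θstar ∈ Θ₀) (hN : ∀ᶠ n in atTop, N n ⊆ Θ₀)
    (hs : L2Shrinking P₀ ρ θstar N) :
    UniformlySmall Pr N fun n ω θ => ‖(empiricalProcess P₀ n (sample X n ω) (ρ θ)
      - empiricalProcess P₀ n (sample X n ω) (ρ θstar))‖ := by
  have hcoord : ∀ j : Fin k, UniformlySmall Pr N fun n ω θ =>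
      |(empiricalProcess P₀ n (sample X n ω) (ρ θ) j
        - empiricalProcess P₀ n (sample X n ω) (ρ θstar) j)| := by
    intro j
    refine .of_eventually_le fun η hη ε hε => ?_
    obtain ⟨δ, hδ, hev⟩ := hD.asymptotic_equicontinuity (f₀ := fun y => ρ θstar y j)
      ⟨θstar, hstar, j, rfl⟩ hη hε
    filter_upwards [hev, hN, hs δ hδ] with n hn hNn hsn
    refine (hX.measure_sample_le ?_).trans hn
    rintro ω ⟨θ, hθ, hlt⟩
    refine ⟨fun y => ρ θ y j, ⟨θ, hNn hθ, j, rfl⟩, hsn θ hθ j, ?_⟩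
    have hi : ∀ θ, Integrable (fun y => ρ θ y j) P₀ := fun θ =>
      (EuclideanSpace.proj (𝕜 := ℝ) j).integrable_comp (hρ_int θ)
    rwa [empiricalProcess_sub _ (hi θ) (hi θstar),
      ← empiricalProcess_apply_coord (hρ_int θ), ← empiricalProcess_apply_coord (hρ_int θstar)]
  refine UniformlySmall.of_finite hcoord fun ε hε => ⟨ε / (k + 1), by positivity, ?_⟩
  refine Eventually.of_forall fun n ω h θ hθ => norm_le_of_forall_abs_le hε.le fun j => ?_
  simpa using h θ hθ j

lemma uniformlySmall_second_moment_sub (hX : IsIIDSample Pr P₀ X)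
    (hD : IsDonsker P₀ (momentClass ρ Θ₀)) (hstar : θstar ∈ Θ₀) (hN : ∀ᶠ n in atTop, N n ⊆ Θ₀)
    (hs : L2Shrinking P₀ ρ θstar N) (j : Fin k) :
    UniformlySmall Pr N fun n ω θ => (n : ℝ)⁻¹ *
      ∑ i, (ρ θ (sample X n ω i) j - ρ θstar (sample X n ω i) j) ^ 2 := by
  refine .of_eventually_le fun η hη ε hε => ?_
  obtain ⟨δ, hδ, hev⟩ := hD.second_moment_small (f₀ := fun y => ρ θstar y j)
    ⟨θstar, hstar, j, rfl⟩ hη hε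
  filter_upwards [hev, hN, hs δ hδ] with n hn hNn hsn
  refine (hX.measure_sample_le ?_).trans hn
  rintro ω ⟨θ, hθ, hlt⟩
  exact ⟨fun y => ρ θ y j, ⟨θ, hNn hθ, j, rfl⟩, hsn θ hθ j, hlt⟩

omit [IsProbabilityMeasure P₀] in
/-- The weak law of large numbers. -/
lemma uniformlySmall_average_sub [IsProbabilityMeasure Pr] (hX : IsIIDSample Pr P₀ X) {f : 𝒳 → ℝ} (hf : Measurable f)
    (hfi : Integrable f P₀) :
    UniformlySmall Pr N fun n ω _ =>
      |(n : ℝ)⁻¹ * ∑ i, f (sample X n ω i) - ∫ y, f y ∂P₀| := by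
  refine UniformlySmall.of_tendstoInMeasure (tendstoInMeasure_of_tendsto_ae (fun n => ?_) ?_)
  · refine Measurable.aestronglyMeasurable (Measurable.const_mul
      (Finset.measurable_fun_sum _ fun i _ => ?_) _)
    exact hf.comp (hX.law i).measurable
  · have h := strong_law_ae_real (fun n ω => f (X n ω))
      ((hX.law 0).integrable_comp_of_integrable hfi)
      (fun i j hij => (hX.indep.indepFun hij).comp hf hf)
      (fun i => (IdentDistrib.mk (hX.law i).measurable.aemeasurable
        (hX.law 0).measurable.aemeasurable
        ((hX.law i).map_eq.trans (hX.law 0).map_eq.symm)).comp hf)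
    filter_upwards [h] with ω hω
    have h0 : ∫ ω, f (X 0 ω) ∂Pr = ∫ y, f y ∂P₀ := (hX.law 0).hasLaw.integral_comp hfi.1
    rw [h0] at hω
    refine hω.congr fun n => ?_
    rw [Finset.sum_range, div_eq_inv_mul]
    rfl

/-- Chebyshev's inequality in each coordinate gives tightness with a bound valid for every `n`. -/
lemma exists_measure_norm_empiricalProcess_gt_le (hX : IsIIDSample Pr P₀ X)
    {f : 𝒳 → EuclideanSpace ℝ (Fin k)} (hfi : Integrable f P₀)
    (hf : ∀ j, MemLp (fun y => f y j) 2 P₀) {ε : ℝ} (hε : 0 < ε) :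
    ∃ M, ∀ n, Pr {ω | M < ‖(empiricalProcess P₀ n (sample X n ω) f)‖} ≤ ENNReal.ofReal ε := by
  set C := ∑ j, ∫ y, f y j ^ 2 ∂P₀ with hC
  have hC0 : 0 ≤ C := Finset.sum_nonneg fun j _ => integral_nonneg fun y => sq_nonneg _
  set m := Real.sqrt ((C + 1) / ε) with hm
  have hm0 : 0 < m := Real.sqrt_pos.2 (by positivity)
  refine ⟨m * (k + 1), fun n => ?_⟩
  calc Pr {ω | m * (k + 1) < ‖(empiricalProcess P₀ n (sample X n ω) f)‖}
      ≤ (Measure.pi fun _ : Fin n => P₀)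
        (⋃ j, {x | m < |(empiricalProcess P₀ n x fun y => f y j)|}) := by
        refine hX.measure_sample_le fun ω hω => ?_
        by_contra hcon
        simp only [Set.mem_iUnion, Set.mem_ofPred_eq, not_exists, not_lt] at hcon
        refine absurd (norm_le_of_forall_abs_le (v := empiricalProcess P₀ n (sample X n ω) f)
          (η := m * (k + 1)) (by positivity) fun j => ?_) (not_le.2 hω)
        rw [empiricalProcess_apply_coord hfi, mul_div_cancel_right₀ _ (by positivity)]
        exact hcon j
    _ ≤ ∑ j, ENNReal.ofReal ((∫ y, f y j ^ 2 ∂P₀) / m ^ 2) :=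
        (measure_iUnion_fintype_le _ _).trans
          (Finset.sum_le_sum fun j _ => measure_empiricalProcess_gt_le (hf j) hm0)
    _ = ENNReal.ofReal (C / m ^ 2) := by
        rw [← ENNReal.ofReal_sum_of_nonneg fun j _ =>
          div_nonneg (integral_nonneg fun y => sq_nonneg _) (sq_nonneg _), hC, Finset.sum_div]
    _ ≤ ENNReal.ofReal ε := by
        refine ENNReal.ofReal_le_ofReal ?_
        rw [hm, Real.sq_sqrt (by positivity), div_div_eq_mul_div, div_le_iff₀ (by positivity)]
        nlinarith

end Local

/-! ### The sample variance -/

section SampleVariance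

lemma abs_average_mul_le {n : ℕ} {x y : Fin n → ℝ} {α β : ℝ} (hα : 0 ≤ α) (hβ : 0 ≤ β)
    (hx : (n : ℝ)⁻¹ * ∑ i, x i ^ 2 ≤ α ^ 2) (hy : (n : ℝ)⁻¹ * ∑ i, y i ^ 2 ≤ β ^ 2) :
    |(n : ℝ)⁻¹ * ∑ i, x i * y i| ≤ α * β := by
  refine abs_le_of_sq_le_sq ?_ (by positivity)
  have h := Finset.sum_mul_sq_le_sq_mul_sq Finset.univ x y
  have hx0 : 0 ≤ (n : ℝ)⁻¹ * ∑ i, x i ^ 2 :=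
    mul_nonneg (by positivity) (Finset.sum_nonneg fun _ _ => sq_nonneg _)
  have hy0 : 0 ≤ (n : ℝ)⁻¹ * ∑ i, y i ^ 2 :=
    mul_nonneg (by positivity) (Finset.sum_nonneg fun _ _ => sq_nonneg _)
  calc ((n : ℝ)⁻¹ * ∑ i, x i * y i) ^ 2
      = (n : ℝ)⁻¹ ^ 2 * (∑ i, x i * y i) ^ 2 := by ring
    _ ≤ (n : ℝ)⁻¹ ^ 2 * ((∑ i, x i ^ 2) * ∑ i, y i ^ 2) := by gcongr
    _ = ((n : ℝ)⁻¹ * ∑ i, x i ^ 2) * ((n : ℝ)⁻¹ * ∑ i, y i ^ 2) := by ring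
    _ ≤ α ^ 2 * β ^ 2 := by gcongr
    _ = (α * β) ^ 2 := by ring

lemma abs_average_le {n : ℕ} {x : Fin n → ℝ} {α : ℝ} (hα : 0 ≤ α)
    (hx : (n : ℝ)⁻¹ * ∑ i, x i ^ 2 ≤ α ^ 2) : |(n : ℝ)⁻¹ * ∑ i, x i| ≤ α := by
  have := abs_average_mul_le (y := fun _ => 1) hα zero_le_one hx (by
    rcases Nat.eq_zero_or_pos n with rfl | hn
    · simp
    · simp [hn.ne'])
  simpa using this

/-- Expanding `uv` around `pq` leaves errors `η²`, `Cη`, `Cη` and `η`; the product of the means is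
at most `4η²`. Since `η ≤ 1`, these add up to the stated constant. -/
lemma abs_average_mul_sub_le {n : ℕ} {u v p q : Fin n → ℝ} {η C ω : ℝ} (hη : 0 ≤ η) (hη1 : η ≤ 1)
    (hC : 0 ≤ C)
    (hu : (n : ℝ)⁻¹ * ∑ i, (u i - p i) ^ 2 ≤ η ^ 2) (hv : (n : ℝ)⁻¹ * ∑ i, (v i - q i) ^ 2 ≤ η ^ 2)
    (hp : (n : ℝ)⁻¹ * ∑ i, p i ^ 2 ≤ C ^ 2) (hq : (n : ℝ)⁻¹ * ∑ i, q i ^ 2 ≤ C ^ 2)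
    (hp1 : |(n : ℝ)⁻¹ * ∑ i, p i| ≤ η) (hq1 : |(n : ℝ)⁻¹ * ∑ i, q i| ≤ η)
    (hpq : |(n : ℝ)⁻¹ * ∑ i, p i * q i - ω| ≤ η) :
    |(n : ℝ)⁻¹ * ∑ i, u i * v i - ((n : ℝ)⁻¹ * ∑ i, u i) * ((n : ℝ)⁻¹ * ∑ i, v i) - ω|
      ≤ (6 + 2 * C) * η := by
  have h1 := abs_average_mul_le hη hη hu hv
  have h2 := abs_average_mul_le hC hη hp hv
  have h3 := abs_average_mul_le hη hC hu hq
  have h4 := abs_average_le hη hu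
  have h5 := abs_average_le hη hv
  have e1 : (n : ℝ)⁻¹ * ∑ i, u i * v i = (n : ℝ)⁻¹ * ∑ i, (u i - p i) * (v i - q i)
      + (n : ℝ)⁻¹ * ∑ i, p i * (v i - q i) + (n : ℝ)⁻¹ * ∑ i, (u i - p i) * q i
      + (n : ℝ)⁻¹ * ∑ i, p i * q i := by
    simp only [← mul_add, ← Finset.sum_add_distrib]
    congr 1
    exact Finset.sum_congr rfl fun i _ => by ring
  have e2 : (n : ℝ)⁻¹ * ∑ i, u i = (n : ℝ)⁻¹ * ∑ i, (u i - p i) + (n : ℝ)⁻¹ * ∑ i, p i := by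
    simp only [← mul_add, ← Finset.sum_add_distrib]
    simp
  have e3 : (n : ℝ)⁻¹ * ∑ i, v i = (n : ℝ)⁻¹ * ∑ i, (v i - q i) + (n : ℝ)⁻¹ * ∑ i, q i := by
    simp only [← mul_add, ← Finset.sum_add_distrib]
    simp
  have h6 : |(n : ℝ)⁻¹ * ∑ i, u i| ≤ 2 * η := by
    rw [e2]; exact (abs_add_le _ _).trans (by linarith)
  have h7 : |(n : ℝ)⁻¹ * ∑ i, v i| ≤ 2 * η := by
    rw [e3]; exact (abs_add_le _ _).trans (by linarith)
  have h8 : |((n : ℝ)⁻¹ * ∑ i, u i) * ((n : ℝ)⁻¹ * ∑ i, v i)| ≤ 2 * η * (2 * η) := by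
    rw [abs_mul]; gcongr
  rw [e1]
  have h9 : η * η ≤ η := by nlinarith
  rw [abs_le] at *
  constructor <;> linarith [h1.1, h1.2, h2.1, h2.2, h3.1, h3.2, h8.1, h8.2, hpq.1, hpq.2]

variable {S 𝒳 Θ : Type*} [MeasurableSpace S] [MeasurableSpace 𝒳] {Pr : Measure S}
  {P₀ : Measure 𝒳} [IsProbabilityMeasure P₀] {X : ℕ → S → 𝒳} {k : ℕ}
  {ρ : Θ → 𝒳 → EuclideanSpace ℝ (Fin k)} {θstar : Θ} {N : ℕ → Set Θ} {Θ₀ : Set Θ}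

/-- Uniform consistency of the sample variance over shrinking sets. -/
lemma uniformlySmall_sampleVariance_sub [IsProbabilityMeasure Pr] (hX : IsIIDSample Pr P₀ X)
    (hρ_int : ∀ θ, Integrable (ρ θ) P₀)
    (hD : IsDonsker P₀ (momentClass ρ Θ₀)) (hstar : θstar ∈ Θ₀) (hN : ∀ᶠ n in atTop, N n ⊆ Θ₀)
    (hs : L2Shrinking P₀ ρ θstar N) (h0 : popMoment P₀ ρ θstar = 0) (a b : Fin k) :
    UniformlySmall Pr N fun n ω θ => |sampleVariance ρ n (sample X n ω) θ a b
      - ∫ y, ρ θstar y a * ρ θstar y b ∂P₀| := by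
  have hL2 : ∀ j, MemLp (fun y => ρ θstar y j) 2 P₀ := fun j =>
    (hD.1 _ ⟨θstar, hstar, j, rfl⟩).2
  have hm : ∀ j, Measurable fun y => ρ θstar y j := fun j => (hD.1 _ ⟨θstar, hstar, j, rfl⟩).1
  have hmean : ∀ j, ∫ y, ρ θstar y j ∂P₀ = 0 := fun j => by
    rw [← integral_apply_coord (hρ_int θstar)]
    change popMoment P₀ ρ θstar j = 0
    rw [h0]; rfl
  have hprod : ∀ i j : Fin k, Integrable (fun y => ρ θstar y i * ρ θstar y j) P₀ := fun i j =>
    (hL2 i).integrable_mul (hL2 j)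
  have hA : ∀ j, UniformlySmall Pr N fun n ω θ => (n : ℝ)⁻¹ *
      ∑ i, (ρ θ (sample X n ω i) j - ρ θstar (sample X n ω i) j) ^ 2 := fun j =>
    uniformlySmall_second_moment_sub hX hD hstar hN hs j
  have hB : ∀ j, UniformlySmall Pr N fun n ω _ =>
      |(n : ℝ)⁻¹ * ∑ i, ρ θstar (sample X n ω i) j| := fun j => by
    simpa [hmean] using uniformlySmall_average_sub (N := N) hX (hm j)
      ((hL2 j).integrable one_le_two)
  have hE : ∀ p : Fin k × Fin k, UniformlySmall Pr N fun n ω _ =>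
      |(n : ℝ)⁻¹ * ∑ i, ρ θstar (sample X n ω i) p.1 * ρ θstar (sample X n ω i) p.2
        - ∫ y, ρ θstar y p.1 * ρ θstar y p.2 ∂P₀| := fun p =>
    uniformlySmall_average_sub hX (f := fun y => ρ θstar y p.1 * ρ θstar y p.2)
      ((hm p.1).mul (hm p.2)) (hprod p.1 p.2)
  refine UniformlySmall.of_finite (UniformlySmall.sumElim hA (UniformlySmall.sumElim hB hE))
    fun ε hε => ?_
  set C := 1 + ∑ j, ∫ y, ρ θstar y j * ρ θstar y j ∂P₀ with hC
  have hCj : ∀ j, ∫ y, ρ θstar y j * ρ θstar y j ∂P₀ + 1 ≤ C := fun j => by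
    have := Finset.single_le_sum (f := fun j => ∫ y, ρ θstar y j * ρ θstar y j ∂P₀)
      (fun i _ => integral_nonneg fun y => mul_self_nonneg _) (Finset.mem_univ j)
    simp only at this
    linarith
  have hC1 : 1 ≤ C := by
    have := Finset.sum_nonneg (s := Finset.univ) (f := fun j => ∫ y, ρ θstar y j * ρ θstar y j ∂P₀)
      (fun i _ => integral_nonneg fun y => mul_self_nonneg _)
    linarith
  set η := min 1 (ε / (6 + 2 * C)) with hη
  have hη0 : 0 < η := by positivity
  have hη1 : η ≤ 1 := min_le_left _ _
  have hηε : (6 + 2 * C) * η ≤ ε := by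
    have : η ≤ ε / (6 + 2 * C) := min_le_right _ _
    rw [le_div_iff₀ (by positivity)] at this
    linarith
  -- The tolerance is `η ^ 2` because the error of the increments is measured by a squared norm; for
  -- the other terms it is more than enough.
  refine ⟨η ^ 2, by positivity, Eventually.of_forall fun n ω h θ hθ => ?_⟩
  have h2 : η ^ 2 ≤ η := by nlinarith
  have hd : ∀ j, (n : ℝ)⁻¹ * ∑ i, (ρ θ (sample X n ω i) j - ρ θstar (sample X n ω i) j) ^ 2
      ≤ η ^ 2 := fun j => h θ hθ (Sum.inl j)
  have hb : ∀ j, |(n : ℝ)⁻¹ * ∑ i, ρ θstar (sample X n ω i) j| ≤ η := fun j =>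
    (h θ hθ (Sum.inr (Sum.inl j))).trans h2
  have he : ∀ i j, |(n : ℝ)⁻¹ * ∑ l, ρ θstar (sample X n ω l) i * ρ θstar (sample X n ω l) j
        - ∫ y, ρ θstar y i * ρ θstar y j ∂P₀| ≤ η := fun i j =>
    (h θ hθ (Sum.inr (Sum.inr (i, j)))).trans h2
  have hsq : ∀ j, (n : ℝ)⁻¹ * ∑ i, ρ θstar (sample X n ω i) j ^ 2 ≤ C ^ 2 := fun j => by
    have h3 := (abs_le.1 (he j j)).2
    simp only [← sq] at h3
    have h4 := hCj j
    simp only [← sq] at h4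
    nlinarith
  refine le_trans (le_of_eq ?_) ((abs_average_mul_sub_le hη0.le hη1 (by linarith) (hd a) (hd b)
    (hsq a) (hsq b) (hb a) (hb b) (he a b)).trans hηε)
  simp only [sampleVariance, Matrix.of_apply, sampleMoment_apply_coord]

end SampleVariance

/-! ### Linear algebra -/

section LinearAlgebra

variable {k d : ℕ} {Ω : Matrix (Fin k) (Fin k) ℝ}

lemma quadForm_eq_inner (A : Matrix (Fin k) (Fin k) ℝ) (v : EuclideanSpace ℝ (Fin k)) :
    quadForm A v = inner ℝ v (Matrix.toEuclideanCLM (𝕜 := ℝ) A v) := by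
  rw [Matrix.inner_toEuclideanCLM, quadForm]

lemma quadForm_smul (A : Matrix (Fin k) (Fin k) ℝ) (c : ℝ) (v : EuclideanSpace ℝ (Fin k)) :
    quadForm A (c • v) = c ^ 2 * quadForm A v := by
  simp only [quadForm_eq_inner, map_smul, inner_smul_left, inner_smul_right, RCLike.conj_to_real]
  ring

lemma sqrt_inv_mul_self (hΩ : Ω.PosDef) : CFC.sqrt Ω⁻¹ * CFC.sqrt Ω⁻¹ = Ω⁻¹ :=
  CFC.sqrt_mul_sqrt_self _ hΩ.inv.posSemidef.nonneg

lemma transpose_sqrt_inv (Ω : Matrix (Fin k) (Fin k) ℝ) :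
    (CFC.sqrt Ω⁻¹).transpose = CFC.sqrt Ω⁻¹ := by
  have h : (CFC.sqrt Ω⁻¹).PosSemidef := Matrix.nonneg_iff_posSemidef.1 (CFC.sqrt_nonneg _)
  have := h.isHermitian
  rwa [Matrix.IsHermitian, Matrix.conjTranspose_eq_transpose_of_trivial] at this

lemma inner_invSqrtMul_left (v w : EuclideanSpace ℝ (Fin k)) :
    inner ℝ (invSqrtMul Ω v) w = inner ℝ v (invSqrtMul Ω w) := by
  unfold invSqrtMul
  rw [real_inner_comm, Matrix.inner_toEuclideanCLM, Matrix.inner_toEuclideanCLM]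
  rw [Matrix.dotProduct_mulVec, ← Matrix.mulVec_transpose, transpose_sqrt_inv, dotProduct_comm]

lemma invSqrtMul_invSqrtMul (hΩ : Ω.PosDef) (v : EuclideanSpace ℝ (Fin k)) :
    invSqrtMul Ω (invSqrtMul Ω v) = Matrix.toEuclideanCLM (𝕜 := ℝ) Ω⁻¹ v := by
  rw [← sqrt_inv_mul_self hΩ, map_mul]
  rfl

lemma quadForm_inv_eq (hΩ : Ω.PosDef) (v : EuclideanSpace ℝ (Fin k)) :
    quadForm Ω⁻¹ v = ‖invSqrtMul Ω v‖ ^ 2 := by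
  rw [quadForm_eq_inner, ← invSqrtMul_invSqrtMul hΩ, ← inner_invSqrtMul_left,
    real_inner_self_eq_norm_sq]

lemma invSqrtMul_injective (hΩ : Ω.PosDef) : Function.Injective (invSqrtMul Ω) := by
  have hinv : ∀ v, Matrix.toEuclideanCLM (𝕜 := ℝ) Ω (invSqrtMul Ω (invSqrtMul Ω v)) = v := by
    intro v
    rw [invSqrtMul_invSqrtMul hΩ, ← mul_apply_eq_comp, ← map_mul,
      Matrix.mul_nonsing_inv _ hΩ.det_pos.ne'.isUnit]
    simp
  intro v w h
  rw [← hinv v, h, hinv w]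

lemma invSqrtMul_surjective (hΩ : Ω.PosDef) : Function.Surjective (invSqrtMul Ω) :=
  (LinearMap.injective_iff_surjective
    (f := (Matrix.toEuclideanCLM (𝕜 := ℝ) (CFC.sqrt Ω⁻¹)).toLinearMap)).1
    (invSqrtMul_injective hΩ)

lemma norm_invSqrtMul_le (v : EuclideanSpace ℝ (Fin k)) :
    ‖invSqrtMul Ω v‖ ≤ ‖Matrix.toEuclideanCLM (𝕜 := ℝ) (CFC.sqrt Ω⁻¹)‖ * ‖v‖ :=
  ContinuousLinearMap.le_opNorm _ _

lemma abs_quadForm_le (A : Matrix (Fin k) (Fin k) ℝ) (v : EuclideanSpace ℝ (Fin k)) :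
    |quadForm A v| ≤ ‖Matrix.toEuclideanCLM (𝕜 := ℝ) A‖ * ‖v‖ ^ 2 := by
  rw [quadForm_eq_inner]
  refine (abs_real_inner_le_norm _ _).trans ?_
  calc _ ≤ ‖v‖ * (‖Matrix.toEuclideanCLM (𝕜 := ℝ) A‖ * ‖v‖) := by
        gcongr; exact ContinuousLinearMap.le_opNorm _ _
    _ = _ := by ring

lemma quadForm_sub (A B : Matrix (Fin k) (Fin k) ℝ) (v : EuclideanSpace ℝ (Fin k)) :
    quadForm (A - B) v = quadForm A v - quadForm B v := by
  simp [quadForm, Matrix.sub_mulVec, dotProduct_sub]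

/-- Perturbing the weighting matrix and the argument of a quadratic form. -/
lemma abs_quadForm_sub_le (hΩ : Ω.PosDef) {W : Matrix (Fin k) (Fin k) ℝ}
    {a b : EuclideanSpace ℝ (Fin k)} {R η : ℝ} (ha : ‖a‖ ≤ R) (hη1 : η ≤ 1)
    (hab : ‖b - a‖ ≤ η) (hW : ‖Matrix.toEuclideanCLM (𝕜 := ℝ) (W - Ω⁻¹)‖ ≤ η) :
    |quadForm W b - quadForm Ω⁻¹ a| ≤ ((R + 1) ^ 2 +
      ‖Matrix.toEuclideanCLM (𝕜 := ℝ) (CFC.sqrt Ω⁻¹)‖ ^ 2 * (2 * R + 1)) * η := by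
  set c := ‖Matrix.toEuclideanCLM (𝕜 := ℝ) (CFC.sqrt Ω⁻¹)‖
  have hR : 0 ≤ R := (norm_nonneg _).trans ha
  have hη : 0 ≤ η := (norm_nonneg _).trans hab
  have hb : ‖b‖ ≤ R + 1 := by
    have := norm_add_le a (b - a)
    rw [add_sub_cancel] at this
    linarith
  have h1 : |quadForm W b - quadForm Ω⁻¹ b| ≤ η * (R + 1) ^ 2 := by
    rw [← quadForm_sub]
    exact (abs_quadForm_le _ _).trans (by gcongr)
  have h2 : |quadForm Ω⁻¹ b - quadForm Ω⁻¹ a| ≤ c ^ 2 * (2 * R + 1) * η := by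
    rw [quadForm_inv_eq hΩ, quadForm_inv_eq hΩ, sq_sub_sq, abs_mul]
    have h3 : |‖invSqrtMul Ω b‖ + ‖invSqrtMul Ω a‖| ≤ c * (2 * R + 1) := by
      rw [abs_of_nonneg (by positivity)]
      calc _ ≤ c * ‖b‖ + c * ‖a‖ := add_le_add (norm_invSqrtMul_le b) (norm_invSqrtMul_le a)
        _ = c * (‖b‖ + ‖a‖) := by ring
        _ ≤ c * (2 * R + 1) := mul_le_mul_of_nonneg_left (by linarith) (norm_nonneg _)
    have h4 : |‖invSqrtMul Ω b‖ - ‖invSqrtMul Ω a‖| ≤ c * η := by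
      refine (abs_norm_sub_norm_le _ _).trans ?_
      have : invSqrtMul Ω b - invSqrtMul Ω a = invSqrtMul Ω (b - a) := by simp [invSqrtMul]
      rw [this]
      exact (norm_invSqrtMul_le _).trans (by gcongr)
    calc _ ≤ c * (2 * R + 1) * (c * η) := by gcongr
      _ = _ := by ring
  calc _ ≤ |quadForm W b - quadForm Ω⁻¹ b| + |quadForm Ω⁻¹ b - quadForm Ω⁻¹ a| :=
        abs_sub_le _ _ _
    _ ≤ _ := by linarith

/-- Generalized inverses of matrices close to `Ω` are close to `Ω⁻¹`. -/
lemma exists_generalizedInverse_close (hΩ : Ω.PosDef) {ε : ℝ} (hε : 0 < ε) :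
    ∃ η > 0, ∀ A B : Matrix (Fin k) (Fin k) ℝ, (∀ a b, |A a b - Ω a b| ≤ η) →
      IsGeneralizedInverse A B → ‖Matrix.toEuclideanCLM (𝕜 := ℝ) (B - Ω⁻¹)‖ ≤ ε := by
  have hdet : Ω.det ≠ 0 := hΩ.det_pos.ne'
  have h1 : ∀ᶠ A in 𝓝 Ω, A.det ≠ 0 :=
    (continuous_id.matrix_det (R := ℝ)).continuousAt.eventually_ne hdet
  have hlin : Continuous fun A : Matrix (Fin k) (Fin k) ℝ =>
      ‖Matrix.toEuclideanCLM (𝕜 := ℝ) A‖ :=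
    (LinearMap.continuous_of_finiteDimensional
      (Matrix.toEuclideanCLM (n := Fin k) (𝕜 := ℝ)).toAlgEquiv.toLinearMap).norm
  have hinv : ContinuousAt (fun A : Matrix (Fin k) (Fin k) ℝ => A⁻¹) Ω := by
    refine continuousAt_matrix_inv Ω ?_
    rw [Ring.inverse_eq_inv']
    exact continuousAt_inv₀ hdet
  have h2 : ∀ᶠ A in 𝓝 Ω, ‖Matrix.toEuclideanCLM (n := Fin k) (𝕜 := ℝ) (A⁻¹ - Ω⁻¹)‖ < ε := by
    have : Tendsto (fun A : Matrix (Fin k) (Fin k) ℝ =>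
        ‖Matrix.toEuclideanCLM (𝕜 := ℝ) (A⁻¹ - Ω⁻¹)‖) (𝓝 Ω) (𝓝 0) := by
      have h3 : Tendsto (fun A : Matrix (Fin k) (Fin k) ℝ => A⁻¹ - Ω⁻¹) (𝓝 Ω) (𝓝 0) := by
        simpa using hinv.tendsto.sub_const Ω⁻¹
      simpa [Function.comp_def] using (hlin.tendsto 0).comp h3
    exact this.eventually_lt_const hε
  obtain ⟨η, hη, hball⟩ := Metric.mem_nhds_iff.1
    (show {A : Fin k → Fin k → ℝ | (Matrix.of A).det ≠ 0 ∧
      ‖Matrix.toEuclideanCLM (n := Fin k) (𝕜 := ℝ) ((Matrix.of A)⁻¹ - Ω⁻¹)‖ < ε} ∈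
        𝓝 (show Fin k → Fin k → ℝ from Ω) from h1.and h2)
  refine ⟨η / 2, by positivity, fun A B hA hB => ?_⟩
  obtain ⟨hd, hn⟩ := @hball A (by
    refine lt_of_le_of_lt ((dist_pi_le_iff (by positivity)).2 fun a =>
      (dist_pi_le_iff (by positivity)).2 fun b => ?_) (half_lt_self hη)
    rw [Real.dist_eq]
    exact hA a b)
  have hu : IsUnit A.det := isUnit_iff_ne_zero.2 hd
  -- Multiplying `A * B * A = A` by `A⁻¹` on both sides removes all freedom in the generalized
  -- inverse.
  have hBA : B = A⁻¹ := by
    have h4 : A⁻¹ * (A * B * A) * A⁻¹ = A⁻¹ * A * A⁻¹ := by rw [hB]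
    rw [← mul_assoc, ← mul_assoc, Matrix.nonsing_inv_mul _ hu, one_mul, one_mul, mul_assoc,
      Matrix.mul_nonsing_inv _ hu, mul_one] at h4
    exact h4
  rw [hBA]
  exact hn.le

lemma sum_castLE_of_vanishing (hdk : d ≤ k) {f : Fin k → ℝ} (hf : ∀ j : Fin k, d ≤ (j : ℕ) → f j = 0) :
    ∑ i : Fin d, f (Fin.castLE hdk i) = ∑ j, f j := by
  refine Fintype.sum_of_injective _ (Fin.castLE_injective hdk) _ _ (fun j hj => hf j ?_)
    fun _ => rfl
  by_contra hlt
  exact hj ⟨⟨j, not_le.1 hlt⟩, rfl⟩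

/-- Only `w` needs a vanishing lower block. This lets `v` be the unrestricted `Ω^{-1/2} Z_n` in the
cross term of the expansion. -/
lemma inner_upper (hdk : d ≤ k) {v w : EuclideanSpace ℝ (Fin k)}
    (hw : ∀ j : Fin k, d ≤ (j : ℕ) → w j = 0) :
    inner ℝ (upper hdk v) (upper hdk w) = inner ℝ v w := by
  simp only [PiLp.inner_apply, upper]
  exact sum_castLE_of_vanishing hdk (f := fun j => inner ℝ (v j) (w j))
    fun j hj => by simp [hw j hj]

lemma norm_upper (hdk : d ≤ k) {w : EuclideanSpace ℝ (Fin k)}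
    (hw : ∀ j : Fin k, d ≤ (j : ℕ) → w j = 0) : ‖upper hdk w‖ = ‖w‖ := by
  have := inner_upper hdk (v := w) hw
  rw [real_inner_self_eq_norm_sq, real_inner_self_eq_norm_sq] at this
  exact (sq_eq_sq₀ (norm_nonneg _) (norm_nonneg _)).1 this

end LinearAlgebra

/-! ### Projection onto a closed convex cone -/

section Cone

variable {E : Type*} [NormedAddCommGroup E] [InnerProductSpace ℝ E] [CompleteSpace E]
  (C : ProperCone ℝ E)

lemma coneProj_mem (v : E) : coneProj C v ∈ C := (exists_nearest C v).choose_spec.1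

lemma norm_sub_coneProj_le (v : E) {u : E} (hu : u ∈ C) : ‖v - coneProj C v‖ ≤ ‖v - u‖ := by
  unfold coneProj
  rw [(exists_nearest C v).choose_spec.2]
  exact ciInf_le ⟨0, by rintro _ ⟨u, rfl⟩; exact norm_nonneg _⟩ (⟨u, hu⟩ : (C : Set E))

lemma norm_sub_coneProj_le_norm (v : E) : ‖v - coneProj C v‖ ≤ ‖v‖ := by
  simpa using norm_sub_coneProj_le C v C.zero_mem

/-- The triangle inequality through `v` suffices, as only a bound linear in `‖v‖` is needed. -/
lemma norm_coneProj_le (v : E) : ‖coneProj C v‖ ≤ 2 * ‖v‖ := by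
  have h1 := norm_sub_coneProj_le_norm C v
  have h2 := norm_sub_le v (v - coneProj C v)
  rw [sub_sub_cancel] at h2
  linarith

variable {C} in
lemma coneProj_eq_self {v : E} (hv : v ∈ C) : coneProj C v = v := by
  have := norm_sub_coneProj_le C v hv
  rw [sub_self, norm_zero, norm_le_zero_iff, sub_eq_zero] at this
  exact this.symm

end Cone

/-! ### The multivariate central limit theorem -/

section CentralLimitTheorem

variable {k d : ℕ}

/-- Extension of a vector by zero entries. -/
def extendZero (hdk : d ≤ k) (t : EuclideanSpace ℝ (Fin d)) : EuclideanSpace ℝ (Fin k) :=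
  WithLp.toLp 2 (Function.extend (Fin.castLE hdk) t.ofLp 0)

lemma extendZero_castLE (hdk : d ≤ k) (t : EuclideanSpace ℝ (Fin d)) (i : Fin d) :
    extendZero hdk t (Fin.castLE hdk i) = t i :=
  (Fin.castLE_injective hdk).extend_apply _ _ i

lemma extendZero_of_le (hdk : d ≤ k) (t : EuclideanSpace ℝ (Fin d)) {j : Fin k}
    (hj : d ≤ (j : ℕ)) : extendZero hdk t j = 0 :=
  Function.extend_apply' _ _ _ fun ⟨i, hi⟩ => absurd i.2 (not_lt.2 (by
    rw [← hi] at hj; exact hj))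

lemma upper_extendZero (hdk : d ≤ k) (t : EuclideanSpace ℝ (Fin d)) :
    upper hdk (extendZero hdk t) = t := by
  ext i
  exact extendZero_castLE hdk t i

lemma inner_upper_eq_inner_extendZero (hdk : d ≤ k) (v : EuclideanSpace ℝ (Fin k))
    (t : EuclideanSpace ℝ (Fin d)) : inner ℝ (upper hdk v) t = inner ℝ v (extendZero hdk t) := by
  rw [← inner_upper hdk fun j hj => extendZero_of_le hdk t hj, upper_extendZero]

lemma norm_extendZero (hdk : d ≤ k) (t : EuclideanSpace ℝ (Fin d)) :
    ‖extendZero hdk t‖ = ‖t‖ := by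
  rw [← norm_upper hdk fun j hj => extendZero_of_le hdk t hj, upper_extendZero]

lemma measurable_upper (hdk : d ≤ k) : Measurable (upper hdk) := by
  unfold upper
  fun_prop

lemma measurable_invSqrtMul (Ω : Matrix (Fin k) (Fin k) ℝ) : Measurable (invSqrtMul Ω) :=
  (Matrix.toEuclideanCLM (𝕜 := ℝ) (CFC.sqrt Ω⁻¹)).continuous.measurable

/-- This is `Ω^{-1/2} Ω Ω^{-1/2} = I`, the source of the identity covariance in the limit. -/
lemma quadForm_invSqrtMul {Ω : Matrix (Fin k) (Fin k) ℝ} (hΩ : Ω.PosDef)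
    (v : EuclideanSpace ℝ (Fin k)) : quadForm Ω (invSqrtMul Ω v) = ‖v‖ ^ 2 := by
  obtain ⟨w, rfl⟩ := invSqrtMul_surjective hΩ v
  have hw : Matrix.toEuclideanCLM (𝕜 := ℝ) Ω (invSqrtMul Ω (invSqrtMul Ω w)) = w := by
    rw [invSqrtMul_invSqrtMul hΩ, ← mul_apply_eq_comp, ← map_mul,
      Matrix.mul_nonsing_inv _ hΩ.det_pos.ne'.isUnit]
    simp
  rw [quadForm_eq_inner, hw, inner_invSqrtMul_left, real_inner_self_eq_norm_sq]

variable {𝒳 : Type*} [MeasurableSpace 𝒳] {P₀ : Measure 𝒳}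

lemma integral_inner_sq {f : 𝒳 → EuclideanSpace ℝ (Fin k)}
    (h2 : ∀ j, MemLp (fun y => f y j) 2 P₀) {Ω : Matrix (Fin k) (Fin k) ℝ}
    (hcov : ∀ i j, ∫ y, f y i * f y j ∂P₀ = Ω i j) (c : EuclideanSpace ℝ (Fin k)) :
    ∫ y, (inner ℝ (f y) c) ^ 2 ∂P₀ = quadForm Ω c := by
  have hi : ∀ i j, Integrable (fun y => c i * c j * (f y i * f y j)) P₀ := fun i j =>
    ((h2 i).integrable_mul (h2 j)).const_mul _
  have h : ∀ y, (inner ℝ (f y) c) ^ 2 = ∑ i, ∑ j, c i * c j * (f y i * f y j) := fun y => by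
    rw [PiLp.inner_apply, sq, Finset.sum_mul_sum]
    refine Finset.sum_congr rfl fun i _ => Finset.sum_congr rfl fun j _ => ?_
    simp only [RCLike.inner_apply, conj_trivial]
    ring
  simp_rw [h]
  rw [integral_finsetSum _ fun i _ => integrable_finsetSum _ fun j _ => hi i j, quadForm]
  simp only [dotProduct, Matrix.mulVec, Finset.mul_sum]
  refine Finset.sum_congr rfl fun i _ => ?_
  rw [integral_finsetSum _ fun j _ => hi i j]
  refine Finset.sum_congr rfl fun j _ => ?_
  rw [integral_const_mul, hcov]
  ring

variable {S : Type*} [MeasurableSpace S] {Pr : Measure S} [IsProbabilityMeasure Pr]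
  {X : ℕ → S → 𝒳}

/-- The Cramér–Wold step: the scalar central limit theorem applied to `⟨f, c⟩`. Evaluating at `1` is
enough because `c` is arbitrary. -/
lemma tendsto_charFun_inner_empiricalProcess (hX : IsIIDSample Pr P₀ X)
    {f : 𝒳 → EuclideanSpace ℝ (Fin k)} (hf : Measurable f) (hfi : Integrable f P₀)
    (h2 : ∀ j, MemLp (fun y => f y j) 2 P₀) (h0 : ∫ y, f y ∂P₀ = 0)
    {Ω : Matrix (Fin k) (Fin k) ℝ}
    (hcov : ∀ i j, ∫ y, f y i * f y j ∂P₀ = Ω i j) (c : EuclideanSpace ℝ (Fin k)) :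
    Tendsto (fun n : ℕ => charFun (Pr.map fun ω =>
      inner ℝ (empiricalProcess P₀ n (sample X n ω) f) c) 1) atTop
        (𝓝 (Complex.exp (-(quadForm Ω c : ℝ) / 2))) := by
  set Y : ℕ → S → ℝ := fun i ω => inner ℝ (f (X i ω)) c with hY
  have hg : Measurable fun y => inner ℝ (f y) c := by fun_prop
  have hgL : MemLp (fun y => inner ℝ (f y) c) 2 P₀ := by
    simp only [PiLp.inner_apply, RCLike.inner_apply, conj_trivial]
    exact memLp_finsetSum _ fun j _ => (h2 j).const_mul (c j)
  have hYL : MemLp (Y 0) 2 Pr := hgL.comp_measurePreserving (hX.law 0)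
  have hmean : Pr[Y 0] = 0 := by
    have h1 : Pr[Y 0] = ∫ y, inner ℝ (f y) c ∂P₀ :=
      (hX.law 0).hasLaw.integral_comp hg.aestronglyMeasurable
    rw [h1]
    simp_rw [real_inner_comm c]
    rw [integral_inner hfi, h0, inner_zero_right]
  have hvar : Var[Y 0; Pr] = quadForm Ω c := by
    rw [variance_of_integral_eq_zero hYL.1.aemeasurable hmean, ← integral_inner_sq h2 hcov c]
    exact (hX.law 0).hasLaw.integral_comp (f := fun y => inner ℝ (f y) c ^ 2)
      (hg.pow_const 2).aestronglyMeasurable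
  have hq : 0 ≤ quadForm Ω c := hvar ▸ variance_nonneg _ _
  have hclt := tendstoInDistribution_inv_sqrt_mul_sum_sub (P := Pr) (X := Y)
    (P' := gaussianReal 0 Var[Y 0; Pr].toNNReal) (Y := id) HasLaw.id hYL
    (hX.indep.comp (fun _ y => inner ℝ (f y) c) fun _ => hg)
    (fun i => (IdentDistrib.mk (hX.law i).measurable.aemeasurable
        (hX.law 0).measurable.aemeasurable
        ((hX.law i).map_eq.trans (hX.law 0).map_eq.symm)).comp hg)
  have hchar := (ProbabilityMeasure.tendsto_iff_tendsto_charFun.1 hclt.tendsto) 1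
  simp only [ProbabilityMeasure.coe_mk, Measure.map_id, charFun_gaussianReal, hmean, hvar] at hchar
  have hfun : ∀ n : ℕ, (fun ω => inner ℝ (empiricalProcess P₀ n (sample X n ω) f) c) =
      fun ω => (Real.sqrt n)⁻¹ * (∑ i ∈ Finset.range n, Y i ω - n * 0) := by
    intro n
    ext ω
    have hsum : ∑ i, inner ℝ (f (sample X n ω i)) c = ∑ i ∈ Finset.range n, Y i ω :=
      (Finset.sum_range fun i => Y i ω).symm
    rw [← hsum, empiricalProcess, h0, sub_zero, inner_smul_left, inner_smul_left, sum_inner,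
      mul_zero, sub_zero, RCLike.conj_to_real, RCLike.conj_to_real, ← mul_assoc]
    congr 1
    rcases Nat.eq_zero_or_pos n with rfl | hn
    · simp
    · have hn' : (0 : ℝ) < n := by exact_mod_cast hn
      have h1 : Real.sqrt n * Real.sqrt n = n := Real.mul_self_sqrt hn'.le
      have h2 : 0 < Real.sqrt n := Real.sqrt_pos.2 hn'
      rw [← div_eq_mul_inv, eq_comm, inv_eq_one_div, div_eq_div_iff h2.ne' hn'.ne', h1, one_mul]
  simp_rw [hfun]
  convert hchar using 2
  simp [hq, neg_div]

lemma tendstoInDistribution_neg_upper_invSqrtMul (hX : IsIIDSample Pr P₀ X)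
    {f : 𝒳 → EuclideanSpace ℝ (Fin k)} (hf : Measurable f) (hfi : Integrable f P₀)
    (h2 : ∀ j, MemLp (fun y => f y j) 2 P₀) (h0 : ∫ y, f y ∂P₀ = 0)
    {Ω : Matrix (Fin k) (Fin k) ℝ} (hΩ : Ω.PosDef)
    (hcov : ∀ i j, ∫ y, f y i * f y j ∂P₀ = Ω i j) (hdk : d ≤ k) :
    TendstoInDistribution (fun n ω =>
        -upper hdk (invSqrtMul Ω (empiricalProcess P₀ n (sample X n ω) f))) atTop
      (id : EuclideanSpace ℝ (Fin d) → EuclideanSpace ℝ (Fin d)) (fun _ => Pr)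
      (multivariateGaussian 0 1) where
  forall_aemeasurable n := by
    have h1 := (measurable_upper hdk).comp ((measurable_invSqrtMul Ω).comp
      ((measurable_empiricalProcess (P := P₀) (n := n) hf).comp
        (hX.measurePreserving_sample n).measurable))
    exact h1.neg.aemeasurable
  tendsto := by
    refine ProbabilityMeasure.tendsto_iff_tendsto_charFun.2 fun t => ?_
    have hinner : ∀ v : EuclideanSpace ℝ (Fin k), inner ℝ (-upper hdk (invSqrtMul Ω v)) t
        = inner ℝ v (invSqrtMul Ω (extendZero hdk (-t))) := fun v => by
      rw [inner_neg_left, ← inner_neg_right, inner_upper_eq_inner_extendZero,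
        inner_invSqrtMul_left]
    have h := tendsto_charFun_inner_empiricalProcess hX hf hfi h2 h0 hcov
      (invSqrtMul Ω (extendZero hdk (-t)))
    rw [quadForm_invSqrtMul hΩ, norm_extendZero, norm_neg] at h
    have hlim : charFun ((multivariateGaussian 0 (1 : Matrix (Fin d) (Fin d) ℝ)).map id) t
        = Complex.exp (-((‖t‖ ^ 2 : ℝ) : ℂ) / 2) := by
      rw [Measure.map_id, multivariateGaussian_zero_one, charFun_stdGaussian]
      simp
    simp only [ProbabilityMeasure.coe_mk]
    rw [hlim]
    refine h.congr fun n => ?_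
    have hZ : Measurable fun ω => empiricalProcess P₀ n (sample X n ω) f :=
      (measurable_empiricalProcess hf).comp (hX.measurePreserving_sample n).measurable
    have hV : Measurable fun ω =>
        -upper hdk (invSqrtMul Ω (empiricalProcess P₀ n (sample X n ω) f)) :=
      ((measurable_upper hdk).comp ((measurable_invSqrtMul Ω).comp hZ)).neg
    have hI : Measurable fun ω => inner ℝ (empiricalProcess P₀ n (sample X n ω) f)
        (invSqrtMul Ω (extendZero hdk (-t))) := hZ.inner_const
    rw [charFun_apply, charFun_apply, integral_map hI.aemeasurable (by fun_prop),
      integral_map hV.aemeasurable (by fun_prop)]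
    simp [hinner]

end CentralLimitTheorem

/-! ### Approximation of the moments by the cone -/

section ConeApproximation

variable {𝒳 Θ : Type*} [MeasurableSpace 𝒳] {P₀ : Measure 𝒳} {k d : ℕ}
  {ρ : Θ → 𝒳 → EuclideanSpace ℝ (Fin k)} {Ω : Matrix (Fin k) (Fin k) ℝ}
  {𝒯 : ProperCone ℝ (EuclideanSpace ℝ (Fin k))}

/-- The distance from `g(θ)` to the cone is `o(‖g(θ)‖)`. -/
lemma exists_norm_sub_coneProj_le
    (hd : ∃ δ : ℝ, 0 < δ ∧
      (fun ε : ℝ => ⨆ θ : enlargement P₀ ρ ε,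
        ‖popMoment P₀ ρ θ - coneProj 𝒯 (popMoment P₀ ρ θ)‖)
        =o[𝓝[>] 0] fun ε : ℝ => ε ^ (1 + δ)) {c : ℝ} (hc : 0 < c) :
    ∃ ε₁ > 0, ∀ ε, 0 < ε → ε < ε₁ → ∀ θ ∈ enlargement P₀ ρ ε,
      ‖popMoment P₀ ρ θ - coneProj 𝒯 (popMoment P₀ ρ θ)‖ ≤ c * ε := by
  obtain ⟨δ, hδ, ho⟩ := hd
  have h1 := ho.def hc
  rw [eventually_nhdsWithin_iff, Metric.eventually_nhds_iff] at h1
  obtain ⟨ε₁, hε₁, h1⟩ := h1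
  refine ⟨min ε₁ 1, by positivity, fun ε hε hlt θ hθ => ?_⟩
  have h2 := h1 (y := ε) (by
    rw [Real.dist_eq, sub_zero, abs_of_pos hε]; exact hlt.trans_le (min_le_left _ _)) hε
  -- A real supremum dominates its terms only when bounded; here `0 ∈ 𝒯` bounds each distance by
  -- `‖g(θ)‖ ≤ ε`.
  have hbdd : BddAbove (Set.range fun θ : enlargement P₀ ρ ε =>
      ‖popMoment P₀ ρ θ - coneProj 𝒯 (popMoment P₀ ρ θ)‖) :=
    ⟨ε, by rintro _ ⟨θ, rfl⟩; exact (norm_sub_coneProj_le_norm 𝒯 _).trans θ.2⟩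
  have h3 := le_ciSup hbdd ⟨θ, hθ⟩
  have h4 : ε ^ (1 + δ) ≤ ε := by
    calc ε ^ (1 + δ) ≤ ε ^ (1 : ℝ) :=
          Real.rpow_le_rpow_of_exponent_ge hε (hlt.le.trans (min_le_right _ _)) (by linarith)
      _ = ε := Real.rpow_one ε
  rw [Real.norm_of_nonneg (Real.rpow_nonneg hε.le _)] at h2
  calc _ ≤ _ := h3
    _ ≤ _ := le_abs_self _
    _ ≤ c * ε ^ (1 + δ) := h2
    _ ≤ c * ε := by gcongr

/-- If the lower block of `Ω^{-1/2} v` vanishes, its upper block determines `v`. -/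
lemma eq_zero_of_upper_invSqrtMul_eq_zero (hΩ : Ω.PosDef) (hdk : d ≤ k)
    {v : EuclideanSpace ℝ (Fin k)} (hv : ∀ j : Fin k, d ≤ (j : ℕ) → invSqrtMul Ω v j = 0)
    (h : upper hdk (invSqrtMul Ω v) = 0) : v = 0 := by
  have h1 : invSqrtMul Ω v = 0 := by
    rw [← norm_eq_zero, ← norm_upper hdk hv, h, norm_zero]
  exact invSqrtMul_injective hΩ (h1.trans (by simp [invSqrtMul]))

lemma upper_invSqrtMul_coneProj_eq_zero_iff (hΩ : Ω.PosDef) (hdk : d ≤ k)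
    (hblock : ∀ v ∈ 𝒯, ∀ j : Fin k, d ≤ (j : ℕ) → invSqrtMul Ω v j = 0)
    {ε₁ : ℝ} (hε₁ : ∀ ε, 0 < ε → ε < ε₁ → ∀ θ ∈ enlargement P₀ ρ ε,
      ‖popMoment P₀ ρ θ - coneProj 𝒯 (popMoment P₀ ρ θ)‖ ≤ 1 / 2 * ε) {θ : Θ}
    (hθ : ‖popMoment P₀ ρ θ‖ < ε₁) :
    upper hdk (invSqrtMul Ω (coneProj 𝒯 (popMoment P₀ ρ θ))) = 0 ↔
      θ ∈ identifiedSet P₀ ρ := by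
  constructor
  · intro h
    have h0 := eq_zero_of_upper_invSqrtMul_eq_zero hΩ hdk (hblock _ (coneProj_mem 𝒯 _)) h
    by_contra hne
    have hpos : 0 < ‖popMoment P₀ ρ θ‖ := norm_pos_iff.2 hne
    -- Taking the radius equal to `‖g(θ)‖` itself, `𝕋g = 0` would give `‖g‖ ≤ ‖g‖ / 2`.
    have := hε₁ _ hpos hθ θ (show ‖popMoment P₀ ρ θ‖ ≤ ‖popMoment P₀ ρ θ‖ from le_rfl)
    rw [h0, sub_zero] at this
    linarith
  · intro h
    rw [show popMoment P₀ ρ θ = 0 from h, coneProj_eq_self 𝒯.zero_mem]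
    ext i
    simp [invSqrtMul, upper]

/-- If `g` covers a neighbourhood of the origin, the cone is the whole space. -/
lemma mem_cone_of_range_mem_nhds
    (hd : ∀ c > 0, ∃ ε₁ > 0, ∀ ε, 0 < ε → ε < ε₁ → ∀ θ ∈ enlargement P₀ ρ ε,
      ‖popMoment P₀ ρ θ - coneProj 𝒯 (popMoment P₀ ρ θ)‖ ≤ c * ε)
    (hnhds : Set.range (popMoment P₀ ρ) ∈ 𝓝 0) (u : EuclideanSpace ℝ (Fin k)) : u ∈ 𝒯 := by
  rcases eq_or_ne u 0 with rfl | hu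
  · exact 𝒯.zero_mem
  have hu' : 0 < ‖u‖ := norm_pos_iff.2 hu
  have hcl : u ∈ closure (𝒯 : Set (EuclideanSpace ℝ (Fin k))) := by
    refine Metric.mem_closure_iff.2 fun c hc => ?_
    obtain ⟨ε₁, hε₁, h1⟩ := hd (c / 2 / ‖u‖) (by positivity)
    obtain ⟨r, hr, hball⟩ := Metric.mem_nhds_iff.1 hnhds
    -- The multiple `t • u` is short enough to be a value of `g` and to satisfy the distance bound.
    -- Rescaling by `t⁻¹` stays in the cone and puts a cone point within `c / 2` of `u`.
    set t := min ε₁ r / (2 * ‖u‖) with ht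
    have ht0 : 0 < t := by positivity
    have htn : ‖t • u‖ = min ε₁ r / 2 := by
      rw [norm_smul, Real.norm_of_nonneg ht0.le, ht]; field_simp
    have hm : 0 < min ε₁ r := by positivity
    obtain ⟨θ, hθ⟩ := hball (show t • u ∈ Metric.ball 0 r by
      rw [mem_ball_zero_iff, htn]
      linarith [min_le_right ε₁ r])
    have h2 := h1 ‖t • u‖ (by rw [htn]; positivity) (by rw [htn]; linarith [min_le_left ε₁ r]) θ
      (by rw [enlargement, Set.mem_ofPred_eq, hθ])
    rw [hθ] at h2
    refine ⟨t⁻¹ • coneProj 𝒯 (t • u),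
      𝒯.smul_mem (coneProj_mem 𝒯 _) (inv_pos.2 ht0).le, ?_⟩
    have h3 : u - t⁻¹ • coneProj 𝒯 (t • u) = t⁻¹ • (t • u - coneProj 𝒯 (t • u)) := by
      rw [smul_sub, inv_smul_smul₀ ht0.ne']
    rw [dist_eq_norm, h3, norm_smul, Real.norm_of_nonneg (inv_pos.2 ht0).le]
    calc t⁻¹ * ‖t • u - coneProj 𝒯 (t • u)‖ ≤ t⁻¹ * (c / 2 / ‖u‖ * ‖t • u‖) := by gcongr
      _ = c / 2 := by
        rw [norm_smul, Real.norm_of_nonneg ht0.le]; field_simp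
      _ < c := half_lt_self hc
  rwa [𝒯.isClosed.closure_eq] at hcl

/-- By surjectivity of `Ω^{-1/2}`, a genuine lower block would contain a basis vector of its range.
-/
lemma eq_of_forall_invSqrtMul_vanishing (hΩ : Ω.PosDef) (hdk : d ≤ k)
    (h : ∀ v, ∀ j : Fin k, d ≤ (j : ℕ) → invSqrtMul Ω v j = 0) : d = k := by
  by_contra hne
  have hlt : d < k := lt_of_le_of_ne hdk hne
  obtain ⟨v, hv⟩ := invSqrtMul_surjective hΩ (EuclideanSpace.single ⟨d, hlt⟩ (1 : ℝ))
  have := h v ⟨d, hlt⟩ le_rfl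
  rw [hv] at this
  simp at this

end ConeApproximation

/-! ### The local quadratic approximation -/

/-- If each row tends to zero, so does some diagonal sequence. -/
lemma exists_diagonal_tendsto_zero {F : ℕ → ℕ → ℝ≥0∞}
    (hF : ∀ K, Tendsto (F K) atTop (𝓝 0)) :
    ∃ κ : ℕ → ℕ, Tendsto κ atTop atTop ∧ Tendsto (fun n => F (κ n) n) atTop (𝓝 0) := by
  have h : ∀ K : ℕ, ∃ m, ∀ n ≥ m, F K n ≤ ((K : ℝ≥0∞) + 1)⁻¹ := fun K =>
    eventually_atTop.1 (ENNReal.tendsto_nhds_zero.1 (hF K) _ (by simp))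
  choose m hm using h
  -- The largest row index already under control at time `n`; it is unbounded because every row is
  -- eventually controlled.
  set κ : ℕ → ℕ := fun n => Nat.findGreatest (fun K => m K ≤ n) n with hκ
  have hκt : Tendsto κ atTop atTop := tendsto_atTop.2 fun K => by
    filter_upwards [eventually_ge_atTop (max K (m K))] with n hn
    exact Nat.le_findGreatest ((le_max_left _ _).trans hn) ((le_max_right _ _).trans hn)
  refine ⟨κ, hκt, ?_⟩
  have hlim : Tendsto (fun n => ((κ n : ℝ≥0∞) + 1)⁻¹) atTop (𝓝 0) := by
    have h1 : Tendsto (fun K : ℕ => ((K : ℝ≥0∞) + 1)⁻¹) atTop (𝓝 0) := by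
      have := (tendsto_add_atTop_iff_nat 1).2 ENNReal.tendsto_inv_nat_nhds_zero
      simpa using this
    exact h1.comp hκt
  refine tendsto_of_tendsto_of_tendsto_of_le_of_le' tendsto_const_nhds hlim
    (Eventually.of_forall fun _ => zero_le) ?_
  filter_upwards [eventually_ge_atTop (m 0)] with n hn
  exact hm (κ n) n (Nat.findGreatest_spec (P := fun K => m K ≤ n) (Nat.zero_le n) hn)

/-! ### The remainder at radius `K/√n` -/

section Expansion

variable {S 𝒳 Θ : Type*} [MeasurableSpace S] [MeasurableSpace 𝒳] {Pr : Measure S}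
  {P₀ : Measure 𝒳} {X : ℕ → S → 𝒳} {k d : ℕ}
  {ρ : Θ → 𝒳 → EuclideanSpace ℝ (Fin k)} {Ω : Matrix (Fin k) (Fin k) ℝ}
  {𝒯 : ProperCone ℝ (EuclideanSpace ℝ (Fin k))} {θstar : Θ}

/-- Completing the square: the local quadratic approximation is a quadratic form in
`Z + √n 𝕋g`. -/
lemma quadratic_approximation_eq (hΩ : Ω.PosDef) (hdk : d ≤ k) {n : ℕ} (hn : 0 < n)
    (Z : EuclideanSpace ℝ (Fin k)) {v : EuclideanSpace ℝ (Fin k)}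
    (hv : ∀ j : Fin k, d ≤ (j : ℕ) → invSqrtMul Ω v j = 0) :
    -(1 / 2) * quadForm Ω⁻¹ Z
        + 1 / 2 * ‖Real.sqrt n • (Real.sqrt n)⁻¹ • -upper hdk (invSqrtMul Ω Z)‖ ^ 2
        - 1 / 2 * ‖Real.sqrt n • ((Real.sqrt n)⁻¹ • -upper hdk (invSqrtMul Ω Z)
          - upper hdk (invSqrtMul Ω v))‖ ^ 2
      = -(1 / 2) * quadForm Ω⁻¹ (Z + Real.sqrt n • v) := by
  have hs : Real.sqrt n ≠ 0 := (Real.sqrt_pos.2 (by exact_mod_cast hn)).ne'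
  rw [smul_sub, smul_inv_smul₀ hs, quadForm_inv_eq hΩ, quadForm_inv_eq hΩ]
  have h1 : invSqrtMul Ω (Z + Real.sqrt n • v)
      = invSqrtMul Ω Z + Real.sqrt n • invSqrtMul Ω v := by simp [invSqrtMul]
  rw [h1, norm_sub_sq_real, norm_add_sq_real, norm_smul, norm_smul, norm_upper hdk hv,
    inner_smul_right, inner_smul_right, inner_neg_left, inner_upper hdk hv]
  ring

lemma nat_mul_gmmCriterion (W : Matrix (Fin k) (Fin k) ℝ) {n : ℕ} (hn : 0 < n)
    (x : Fin n → 𝒳) (θ : Θ) :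
    n * gmmCriterion ρ W n x θ = -(1 / 2) * quadForm W
      (empiricalProcess P₀ n x (ρ θ) + Real.sqrt n • popMoment P₀ ρ θ) := by
  have h : empiricalProcess P₀ n x (ρ θ) + Real.sqrt n • popMoment P₀ ρ θ
      = Real.sqrt n • sampleMoment ρ n x θ := by
    rw [empiricalProcess, popMoment, sampleMoment, smul_sub, sub_add_cancel]
  rw [h, quadForm_smul, Real.sq_sqrt (by positivity), gmmCriterion]
  ring

variable [IsProbabilityMeasure P₀]

lemma tendsto_div_sqrt_nhdsGT {K : ℝ} (hK : 0 < K) :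
    Tendsto (fun n : ℕ => K / Real.sqrt n) atTop (𝓝[>] 0) := by
  refine tendsto_nhdsWithin_iff.2 ⟨?_, ?_⟩
  · exact (Real.tendsto_sqrt_atTop.comp tendsto_natCast_atTop_atTop).const_div_atTop K
  · filter_upwards [eventually_gt_atTop 0] with n hn
    exact div_pos hK (Real.sqrt_pos.2 (by exact_mod_cast hn))

/-- The remainder of the local quadratic approximation. -/
def expansionRemainder (P₀ : Measure 𝒳) (X : ℕ → S → 𝒳) (ρ : Θ → 𝒳 → EuclideanSpace ℝ (Fin k))
    (Ω : Matrix (Fin k) (Fin k) ℝ) (𝒯 : ProperCone ℝ (EuclideanSpace ℝ (Fin k))) (hdk : d ≤ k)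
    (θstar : Θ) (L : ℕ → S → Θ → ℝ) (n : ℕ) (ω : S) (θ : Θ) : ℝ :=
  |n * L n ω θ - (-(1 / 2) * quadForm Ω⁻¹ (empiricalProcess P₀ n (sample X n ω) (ρ θstar))
    + 1 / 2 * ‖Real.sqrt n • (Real.sqrt n)⁻¹ •
      -upper hdk (invSqrtMul Ω (empiricalProcess P₀ n (sample X n ω) (ρ θstar)))‖ ^ 2
    - 1 / 2 * ‖Real.sqrt n • ((Real.sqrt n)⁻¹ •
      -upper hdk (invSqrtMul Ω (empiricalProcess P₀ n (sample X n ω) (ρ θstar)))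
        - upper hdk (invSqrtMul Ω (coneProj 𝒯 (popMoment P₀ ρ θ))))‖ ^ 2)|

/-- The remainder is uniformly small over `{θ : ‖g(θ)‖ ≤ K/√n}`, for fixed `K`. -/
lemma uniformlySmall_expansionRemainder (hX : IsIIDSample Pr P₀ X) (hdk : d ≤ k)
    (hρ_int : ∀ θ, Integrable (ρ θ) P₀) (hΩ : Ω.PosDef)
    (hblock : ∀ v ∈ 𝒯, ∀ j : Fin k, d ≤ (j : ℕ) → invSqrtMul Ω v j = 0)
    (hL2 : ∀ j, MemLp (fun y => ρ θstar y j) 2 P₀)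
    (hd : ∀ c > 0, ∃ ε₁ > 0, ∀ ε, 0 < ε → ε < ε₁ → ∀ θ ∈ enlargement P₀ ρ ε,
      ‖popMoment P₀ ρ θ - coneProj 𝒯 (popMoment P₀ ρ θ)‖ ≤ c * ε)
    {K : ℝ} (hK : 0 < K) {W : ℕ → S → Θ → Matrix (Fin k) (Fin k) ℝ}
    (hG : UniformlySmall Pr (fun n => enlargement P₀ ρ (K / Real.sqrt n)) fun n ω θ =>
      ‖(empiricalProcess P₀ n (sample X n ω) (ρ θ)
        - empiricalProcess P₀ n (sample X n ω) (ρ θstar))‖)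
    (hW : UniformlySmall Pr (fun n => enlargement P₀ ρ (K / Real.sqrt n)) fun n ω θ =>
      ‖Matrix.toEuclideanCLM (𝕜 := ℝ) (W n ω θ - Ω⁻¹)‖) :
    UniformlySmall Pr (fun n => enlargement P₀ ρ (K / Real.sqrt n))
      (expansionRemainder P₀ X ρ Ω 𝒯 hdk θstar fun n ω θ =>
        gmmCriterion ρ (W n ω θ) n (sample X n ω) θ) := by
  -- Truncating at `‖Z_n‖ ≤ M` keeps `Z_n + √n 𝕋g` in a fixed ball, where the quadratic form is
  -- Lipschitz in its argument and its weight.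
  refine UniformlySmall.of_forall_truncation
    (B := fun n ω => ‖(empiricalProcess P₀ n (sample X n ω) (ρ θstar))‖)
    (fun ε hε => exists_measure_norm_empiricalProcess_gt_le hX (hρ_int θstar) hL2 hε)
    fun M => ?_
  refine UniformlySmall.of_finite (ι := Unit ⊕ Unit)
    (UniformlySmall.sumElim (fun _ => hG) fun _ => hW) fun ε hε => ?_
  set R := |M| + 2 * K with hR
  have hR0 : 0 < R := by positivity
  set A := (R + 1) ^ 2 +
    ‖Matrix.toEuclideanCLM (𝕜 := ℝ) (CFC.sqrt Ω⁻¹)‖ ^ 2 * (2 * R + 1) with hA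
  have hA0 : 0 < A := by positivity
  set η := min 1 (ε / A) with hη
  have hη0 : 0 < η := by positivity
  have hηε : A * η ≤ ε := by
    have : η ≤ ε / A := min_le_right _ _
    rw [le_div_iff₀ hA0] at this
    linarith
  refine ⟨η / 2, by positivity, ?_⟩
  -- At radius `K/√n` this constant makes `√n ‖g - 𝕋g‖` at most `η / 2`; equicontinuity supplies the
  -- other half of `η`.
  obtain ⟨ε₁, hε₁, hd1⟩ := hd (η / 2 / K) (by positivity)
  have hev : ∀ᶠ n : ℕ in atTop, K / Real.sqrt n < ε₁ :=
    (tendsto_nhdsWithin_iff.1 (tendsto_div_sqrt_nhdsGT hK)).1.eventually_lt_const hε₁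
  filter_upwards [hev, eventually_gt_atTop 0] with n hn1 hn0 ω h θ hθ
  have hG' := h θ hθ (Sum.inl ())
  have hW' := h θ hθ (Sum.inr ())
  simp only [Sum.elim_inl, Sum.elim_inr] at hG' hW'
  have hsqrt : 0 < Real.sqrt n := Real.sqrt_pos.2 (by exact_mod_cast hn0)
  split_ifs with hM
  swap
  · exact hε.le
  set Z := empiricalProcess P₀ n (sample X n ω) (ρ θstar)
  set g := popMoment P₀ ρ θ with hg
  have hgn : Real.sqrt n * ‖g‖ ≤ K := by
    have : ‖g‖ ≤ K / Real.sqrt n := hθ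
    rwa [le_div_iff₀ hsqrt, mul_comm] at this
  have hproj : Real.sqrt n * ‖g - coneProj 𝒯 g‖ ≤ η / 2 := by
    have h1 := hd1 (K / Real.sqrt n) (by positivity) hn1 θ hθ
    calc Real.sqrt n * ‖g - coneProj 𝒯 g‖
        ≤ Real.sqrt n * (η / 2 / K * (K / Real.sqrt n)) := by gcongr
      _ = η / 2 := by field_simp
  have ha : ‖Z + Real.sqrt n • coneProj 𝒯 g‖ ≤ R := by
    refine (norm_add_le _ _).trans (add_le_add (hM.trans (le_abs_self M)) ?_)
    rw [norm_smul, Real.norm_of_nonneg hsqrt.le]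
    calc _ ≤ Real.sqrt n * (2 * ‖g‖) := by gcongr; exact norm_coneProj_le 𝒯 g
      _ ≤ 2 * K := by linarith
  have hab : ‖(empiricalProcess P₀ n (sample X n ω) (ρ θ) + Real.sqrt n • g)
      - (Z + Real.sqrt n • coneProj 𝒯 g)‖ ≤ η := by
    have : (empiricalProcess P₀ n (sample X n ω) (ρ θ) + Real.sqrt n • g)
      - (Z + Real.sqrt n • coneProj 𝒯 g) = (empiricalProcess P₀ n (sample X n ω) (ρ θ) - Z)
        + Real.sqrt n • (g - coneProj 𝒯 g) := by module
    rw [this]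
    refine (norm_add_le _ _).trans ?_
    rw [norm_smul, Real.norm_of_nonneg hsqrt.le]
    linarith
  have hmain := abs_quadForm_sub_le hΩ ha (min_le_left _ _) hab (hW'.trans (by linarith))
  rw [expansionRemainder, quadratic_approximation_eq hΩ hdk hn0 _
    (hblock _ (coneProj_mem 𝒯 _)), nat_mul_gmmCriterion (P₀ := P₀) _ hn0, ← mul_sub, abs_mul]
  refine le_trans ?_ (hmain.trans hηε)
  rw [abs_of_neg (by norm_num)]
  linarith [abs_nonneg (quadForm (W n ω θ) (empiricalProcess P₀ n (sample X n ω) (ρ θ) +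
    Real.sqrt n • g) - quadForm Ω⁻¹ (Z + Real.sqrt n • coneProj 𝒯 g))]

end Expansion

/-! ### Slowly growing radius and assembly of the conclusion -/

section LocalGMM

variable {S 𝒳 Θ : Type*} [MeasurableSpace S] [MeasurableSpace 𝒳] {Pr : Measure S}
  {P₀ : Measure 𝒳} {X : ℕ → S → 𝒳} {k d : ℕ}
  {ρ : Θ → 𝒳 → EuclideanSpace ℝ (Fin k)} {Ω : Matrix (Fin k) (Fin k) ℝ}
  {𝒯 : ProperCone ℝ (EuclideanSpace ℝ (Fin k))} {θstar : Θ}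

/-- A slowly growing radius along which a remainder, negligible at each fixed multiple of
`n^{-1/2}`, stays negligible. -/
lemma exists_radius {D : ℕ → S → Θ → ℝ}
    (hD : ∀ K : ℝ, 0 < K → UniformlySmall Pr (fun n => enlargement P₀ ρ (K / Real.sqrt n)) D) :
    ∃ r : ℕ → ℝ, (∀ n, 0 < r n) ∧ Tendsto r atTop atTop ∧
      r =o[atTop] (fun n : ℕ => (n : ℝ) ^ (1 / 4 : ℝ)) ∧
      UniformlySmall Pr (fun n => enlargement P₀ ρ (r n / Real.sqrt n)) D := by
  have hpow : Tendsto (fun n : ℕ => (n : ℝ) ^ (1 / 4 : ℝ)) atTop atTop :=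
    (tendsto_rpow_atTop (by norm_num)).comp tendsto_natCast_atTop_atTop
  -- Adding `(K + 1)/n^{1/4}` to the probability makes a single diagonal choice control both the
  -- remainder and the growth of the radius. The threshold `(K + 1)⁻¹` shrinks along the diagonal,
  -- so it falls below every `η`.
  obtain ⟨κ, hκ, hlim⟩ := exists_diagonal_tendsto_zero
    (F := fun K n => Pr {ω | ∃ θ ∈ enlargement P₀ ρ (((K : ℝ) + 1) / Real.sqrt n),
      ((K : ℝ) + 1)⁻¹ < D n ω θ} + ENNReal.ofReal (((K : ℝ) + 1) / (n : ℝ) ^ (1 / 4 : ℝ)))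
    (fun K => by
      have h1 := hD ((K : ℝ) + 1) (by positivity) ((K : ℝ) + 1)⁻¹ (by positivity)
      have h2 := ENNReal.tendsto_ofReal (hpow.const_div_atTop ((K : ℝ) + 1))
      simpa using h1.add h2)
  have hr : Tendsto (fun n => (κ n : ℝ) + 1) atTop atTop :=
    tendsto_atTop_add_const_right _ _ (tendsto_natCast_atTop_atTop.comp hκ)
  refine ⟨fun n => κ n + 1, fun n => by positivity, hr, ?_, ?_⟩
  · refine (isLittleO_iff_tendsto' ?_).2 ?_
    · filter_upwards [eventually_gt_atTop 0] with n hn h0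
      exact absurd h0 (Real.rpow_pos_of_pos (by exact_mod_cast hn) _).ne'
    · have h3 : Tendsto (fun n : ℕ => ENNReal.ofReal (((κ n : ℝ) + 1) / (n : ℝ) ^ (1 / 4 : ℝ)))
          atTop (𝓝 0) :=
        tendsto_of_tendsto_of_tendsto_of_le_of_le tendsto_const_nhds hlim
          (fun _ => zero_le) fun _ => le_add_self
      have h4 := (ENNReal.tendsto_toReal ENNReal.zero_ne_top).comp h3
      simp only [ENNReal.toReal_zero] at h4
      refine h4.congr fun n => ?_
      exact ENNReal.toReal_ofReal (by positivity)
  · intro η hη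
    refine tendsto_of_tendsto_of_tendsto_of_le_of_le' tendsto_const_nhds hlim
      (Eventually.of_forall fun _ => zero_le) ?_
    filter_upwards [(tendsto_inv_atTop_zero.comp hr).eventually_lt_const hη] with n hn
    refine le_trans (measure_mono ?_) le_self_add
    rintro ω ⟨θ, hθ, hlt⟩
    exact ⟨θ, hθ, lt_trans hn hlt⟩

variable [IsProbabilityMeasure Pr]

lemma localQuadraticApproximation (hX : IsIIDSample Pr P₀ X) (hdk : d ≤ k)
    (hρ_meas : ∀ θ, Measurable (ρ θ)) (hρ_int : ∀ θ, Integrable (ρ θ) P₀) (hΩ : Ω.PosDef)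
    (hblock : ∀ v ∈ 𝒯, ∀ j : Fin k, d ≤ (j : ℕ) → invSqrtMul Ω v j = 0)
    (hL2 : ∀ j, MemLp (fun y => ρ θstar y j) 2 P₀) (hθstar : θstar ∈ identifiedSet P₀ ρ)
    (hcov : ∀ i j, ∫ y, ρ θstar y i * ρ θstar y j ∂P₀ = Ω i j) {L : ℕ → S → Θ → ℝ} {r : ℕ → ℝ}
    (hr : r =o[atTop] (fun n : ℕ => (n : ℝ) ^ (1 / 4 : ℝ))) (hr0 : ∀ n, 0 < r n)
    (hD : UniformlySmall Pr (fun n => enlargement P₀ ρ (r n / Real.sqrt n))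
      (expansionRemainder P₀ X ρ Ω 𝒯 hdk θstar L)) :
    LocalQuadraticApproximation Pr X L (fun n => enlargement P₀ ρ (r n / Real.sqrt n))
      (fun θ => upper hdk (invSqrtMul Ω (coneProj 𝒯 (popMoment P₀ ρ θ))))
      (fun n x => -(1 / 2) * quadForm Ω⁻¹ (empiricalProcess P₀ n x (ρ θstar)))
      (fun n x => (Real.sqrt n)⁻¹ • -upper hdk (invSqrtMul Ω (empiricalProcess P₀ n x (ρ θstar))))
      (fun n x => -upper hdk (invSqrtMul Ω (empiricalProcess P₀ n x (ρ θstar)))) ⊤ 1 := by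
  have hZ : ∀ n, Measurable fun x : Fin n → 𝒳 => empiricalProcess P₀ n x (ρ θstar) := fun n =>
    measurable_empiricalProcess (hρ_meas θstar)
  have hV : ∀ n, Measurable fun x : Fin n → 𝒳 =>
      -upper hdk (invSqrtMul Ω (empiricalProcess P₀ n x (ρ θstar))) := fun n =>
    ((measurable_upper hdk).comp ((measurable_invSqrtMul Ω).comp (hZ n))).neg
  refine ⟨fun n => ?_, fun n => (continuous_const_smul _).measurable.comp (hV n), hV, fun ε hε => ?_, ?_, fun n x => ?_,
    tendstoInDistribution_neg_upper_invSqrtMul hX (hρ_meas θstar) (hρ_int θstar) hL2 hθstar hΩ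
      hcov hdk⟩
  · simp_rw [quadForm_inv_eq hΩ]
    exact (((measurable_invSqrtMul Ω).comp (hZ n)).norm.pow_const 2).const_mul _
  · refine tendsto_of_tendsto_of_tendsto_of_le_of_le tendsto_const_nhds (hD ε hε)
      (fun _ => zero_le) fun n => measure_mono fun ω hω => ?_
    rw [Set.mem_ofPred_eq, lt_iSup_iff] at hω
    obtain ⟨θ, hlt⟩ := hω
    obtain ⟨hθ, hlt⟩ := lt_iSup_iff.1 hlt
    exact ⟨θ, hθ, (ENNReal.ofReal_lt_ofReal_iff_of_nonneg hε.le).1 hlt⟩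
  · set c := ‖Matrix.toEuclideanCLM (𝕜 := ℝ) (CFC.sqrt Ω⁻¹)‖
    have hpos : ∀ᶠ n : ℕ in atTop, (n : ℝ) ^ (1 / 4 : ℝ) = 0 → r n = 0 := by
      filter_upwards [eventually_gt_atTop 0] with n hn h0
      exact absurd h0 (Real.rpow_pos_of_pos (by exact_mod_cast hn) _).ne'
    have h1 : Tendsto (fun n : ℕ => c * (2 * (r n / (n : ℝ) ^ (1 / 4 : ℝ)))) atTop (𝓝 0) := by
      simpa using (((isLittleO_iff_tendsto' hpos).1 hr).const_mul 2).const_mul c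
    have h2 := ENNReal.tendsto_ofReal h1
    rw [ENNReal.ofReal_zero] at h2
    refine tendsto_of_tendsto_of_tendsto_of_le_of_le' tendsto_const_nhds h2
      (Eventually.of_forall fun _ => zero_le) ?_
    filter_upwards [eventually_gt_atTop 0] with n hn
    refine iSup₂_le fun θ hθ => ?_
    rw [← ofReal_norm]
    refine ENNReal.ofReal_le_ofReal ?_
    rw [norm_upper hdk (hblock _ (coneProj_mem 𝒯 _))]
    have hn1 : (1 : ℝ) ≤ n := by exact_mod_cast hn
    have hle : (n : ℝ) ^ (1 / 4 : ℝ) ≤ Real.sqrt n := by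
      rw [Real.sqrt_eq_rpow]
      exact Real.rpow_le_rpow_of_exponent_le hn1 (by norm_num)
    have hp : 0 < (n : ℝ) ^ (1 / 4 : ℝ) := Real.rpow_pos_of_pos (by linarith) _
    calc _ ≤ c * ‖coneProj 𝒯 (popMoment P₀ ρ θ)‖ := norm_invSqrtMul_le _
      _ ≤ c * (2 * ‖popMoment P₀ ρ θ‖) := by gcongr; exact norm_coneProj_le _ _
      _ ≤ c * (2 * (r n / Real.sqrt n)) := by gcongr; exact hθ
      _ ≤ c * (2 * (r n / (n : ℝ) ^ (1 / 4 : ℝ))) := by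
          gcongr
          exact (hr0 n).le
  · rw [coneProj_eq_self (C := ⊤) Submodule.mem_top]
    -- For `n = 0` the factor `√n (√n)⁻¹` is `0`, but the empirical process vanishes as well.
    rcases Nat.eq_zero_or_pos n with rfl | hn
    · have : (0 : EuclideanSpace ℝ (Fin d)) = -upper hdk 0 := by ext i; simp [upper]
      simpa [empiricalProcess, invSqrtMul] using this
    · exact smul_inv_smul₀ (Real.sqrt_pos.2 (by exact_mod_cast hn)).ne' _

lemma upper_self {k : ℕ} (h : k ≤ k) (v : EuclideanSpace ℝ (Fin k)) : upper h v = v := rfl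

/-- The conclusion for a weighting matrix which is uniformly consistent for `Ω⁻¹` locally. -/
lemma hasLocalGMMExpansion_of_uniformlySmall [IsProbabilityMeasure P₀] (hX : IsIIDSample Pr P₀ X)
    (hdk : d ≤ k)
    (hρ_meas : ∀ θ, Measurable (ρ θ)) (hρ_int : ∀ θ, Integrable (ρ θ) P₀) (hΩ : Ω.PosDef)
    (hblock : ∀ v ∈ 𝒯, ∀ j : Fin k, d ≤ (j : ℕ) → invSqrtMul Ω v j = 0)
    (hL2 : ∀ j, MemLp (fun y => ρ θstar y j) 2 P₀) (hθstar : θstar ∈ identifiedSet P₀ ρ)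
    (hcov : ∀ i j, ∫ y, ρ θstar y i * ρ θstar y j ∂P₀ = Ω i j)
    (hd : ∀ c > 0, ∃ ε₁ > 0, ∀ ε, 0 < ε → ε < ε₁ → ∀ θ ∈ enlargement P₀ ρ ε,
      ‖popMoment P₀ ρ θ - coneProj 𝒯 (popMoment P₀ ρ θ)‖ ≤ c * ε)
    (hG : ∀ K : ℝ, 0 < K → UniformlySmall Pr (fun n => enlargement P₀ ρ (K / Real.sqrt n))
      fun n ω θ => ‖(empiricalProcess P₀ n (sample X n ω) (ρ θ)
        - empiricalProcess P₀ n (sample X n ω) (ρ θstar))‖)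
    {W : ℕ → S → Θ → Matrix (Fin k) (Fin k) ℝ}
    (hW : ∀ K : ℝ, 0 < K → UniformlySmall Pr (fun n => enlargement P₀ ρ (K / Real.sqrt n))
      fun n ω θ => ‖Matrix.toEuclideanCLM (𝕜 := ℝ) (W n ω θ - Ω⁻¹)‖) :
    HasLocalGMMExpansion Pr P₀ X ρ Ω 𝒯 hdk θstar
      (fun n ω θ => gmmCriterion ρ (W n ω θ) n (sample X n ω) θ) := by
  obtain ⟨r, hr0, hr, hro, hrem⟩ := exists_radius fun K hK =>
    uniformlySmall_expansionRemainder hX hdk hρ_int hΩ hblock hL2 hd hK (hG K hK) (hW K hK)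
  have hLQA := localQuadraticApproximation hX hdk hρ_meas hρ_int hΩ hblock hL2 hθstar hcov hro hr0
    hrem
  refine ⟨?_, r, hr0, hr, hro, hLQA, fun hnhds => ?_⟩
  · obtain ⟨ε₁, hε₁, h1⟩ := hd (1 / 2) (by norm_num)
    refine ⟨ε₁ / 2, by positivity, fun θ hθ =>
      upper_invSqrtMul_coneProj_eq_zero_iff hΩ hdk hblock h1 ?_⟩
    exact lt_of_le_of_lt (show ‖popMoment P₀ ρ θ‖ ≤ ε₁ / 2 from hθ) (half_lt_self hε₁)
  · have htop := mem_cone_of_range_mem_nhds hd hnhds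
    have hdk' : d = k := eq_of_forall_invSqrtMul_vanishing hΩ hdk fun v => hblock v (htop v)
    -- With `d = k` and `𝕋g = g`, taking the upper block is the identity, so the full approximation
    -- is the one already proved.
    subst hdk'
    have hproj : ∀ θ, coneProj 𝒯 (popMoment P₀ ρ θ) = popMoment P₀ ρ θ := fun θ =>
      coneProj_eq_self (htop _)
    refine ⟨rfl, hproj, ?_⟩
    simpa only [hproj, upper_self] using hLQA

end LocalGMM

end GMM

end

/-! ### The two weighting schemes -/

theorem propositionp {S 𝒳 Θ : Type*} [MeasurableSpace S] [MeasurableSpace 𝒳]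
    (Pr : Measure S) [IsProbabilityMeasure Pr] (P₀ : Measure 𝒳) [IsProbabilityMeasure P₀]
    (X : ℕ → S → 𝒳) (hX : GMM.IsIIDSample Pr P₀ X)
    {k d : ℕ} (hdk : d ≤ k)
    (ρ : Θ → 𝒳 → EuclideanSpace ℝ (Fin k))
    (hρ_meas : ∀ θ, Measurable (ρ θ)) (hρ_int : ∀ θ, Integrable (ρ θ) P₀)
    (Ω : Matrix (Fin k) (Fin k) ℝ)
    (𝒯 : ProperCone ℝ (EuclideanSpace ℝ (Fin k)))
    -- the entries of `Ω^{-1/2} v` below the first `d` vanish for `v` in the span of the cone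
    (hblock : ∀ v ∈ Submodule.span ℝ (𝒯 : Set (EuclideanSpace ℝ (Fin k))),
      ∀ j : Fin k, d ≤ (j : ℕ) → GMM.invSqrtMul Ω v j = 0)
    -- (a)
    (ha : ∃ ε₀ : ℝ, 0 < ε₀ ∧
      GMM.IsDonsker P₀ (GMM.momentClass ρ (GMM.enlargement P₀ ρ ε₀)))
    -- (b)
    (hb : ∀ θ ∈ GMM.identifiedSet P₀ ρ, ∀ i j : Fin k, ∫ y, ρ θ y i * ρ θ y j ∂P₀ = Ω i j)
    (hΩ : Ω.PosDef)
    -- (c)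
    (θstar : Θ) (hθstar : θstar ∈ GMM.identifiedSet P₀ ρ)
    (hc : Tendsto (fun ε : ℝ => ⨆ θ ∈ GMM.enlargement P₀ ρ ε,
      ∫⁻ y, ‖ρ θ y - ρ θstar y‖ₑ ^ 2 ∂P₀) (𝓝[>] 0) (𝓝 0))
    -- (d)
    (hd : ∃ δ : ℝ, 0 < δ ∧
      (fun ε : ℝ => ⨆ θ : GMM.enlargement P₀ ρ ε,
        ‖GMM.popMoment P₀ ρ θ - GMM.coneProj 𝒯 (GMM.popMoment P₀ ρ θ)‖)
        =o[𝓝[>] 0] fun ε : ℝ => ε ^ (1 + δ))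
    -- the continuously-updated weighting matrix: any generalized inverse of the sample variance
    (W : ∀ n, (Fin n → 𝒳) → Θ → Matrix (Fin k) (Fin k) ℝ)
    (hW : ∀ n x θ, GMM.IsGeneralizedInverse (GMM.sampleVariance ρ n x θ) (W n x θ)) :
    -- continuously-updated GMM
    GMM.HasLocalGMMExpansion Pr P₀ X ρ Ω 𝒯 hdk θstar
      (fun n ω θ => GMM.gmmCriterion ρ (W n (GMM.sample X n ω) θ) n (GMM.sample X n ω) θ) ∧
    -- optimally-weighted GMM
    ∀ What : ℕ → S → Matrix (Fin k) (Fin k) ℝ,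
      TendstoInMeasure Pr
        (fun n ω => ‖Matrix.toEuclideanCLM (𝕜 := ℝ) (What n ω - Ω⁻¹)‖) atTop (fun _ => 0) →
      GMM.HasLocalGMMExpansion Pr P₀ X ρ Ω 𝒯 hdk θstar
        (fun n ω θ => GMM.gmmCriterion ρ (What n ω) n (GMM.sample X n ω) θ) := by

  have hblock' : ∀ v ∈ 𝒯, ∀ j : Fin k, d ≤ (j : ℕ) → GMM.invSqrtMul Ω v j = 0 := fun v hv =>
    hblock v (Submodule.subset_span hv)
  obtain ⟨ε₀, hε₀, hD⟩ := ha
  have hstar0 : GMM.popMoment P₀ ρ θstar = 0 := hθstar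
  have hstar : θstar ∈ GMM.enlargement P₀ ρ ε₀ := by
    change ‖GMM.popMoment P₀ ρ θstar‖ ≤ ε₀
    rw [hstar0, norm_zero]
    exact hε₀.le
  have hL2 : ∀ j, MemLp (fun y => ρ θstar y j) 2 P₀ := fun j =>
    (hD.1 _ ⟨θstar, hstar, j, rfl⟩).2
  have hcov := hb θstar hθstar
  have hd' : ∀ c > 0, ∃ ε₁ > 0, ∀ ε, 0 < ε → ε < ε₁ → ∀ θ ∈ GMM.enlargement P₀ ρ ε,
      ‖GMM.popMoment P₀ ρ θ - GMM.coneProj 𝒯 (GMM.popMoment P₀ ρ θ)‖ ≤ c * ε := fun c hc =>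
    GMM.exists_norm_sub_coneProj_le hd hc
  have hs : ∀ K : ℝ, 0 < K → GMM.L2Shrinking P₀ ρ θstar
      fun n => GMM.enlargement P₀ ρ (K / Real.sqrt n) := fun K hK =>
    GMM.l2Shrinking_of_tendsto hρ_meas hc (GMM.tendsto_div_sqrt_nhdsGT hK)
  have hN : ∀ K : ℝ, 0 < K → ∀ᶠ n : ℕ in atTop,
      GMM.enlargement P₀ ρ (K / Real.sqrt n) ⊆ GMM.enlargement P₀ ρ ε₀ := fun K hK => by
    filter_upwards [(tendsto_nhdsWithin_iff.1
      (GMM.tendsto_div_sqrt_nhdsGT hK)).1.eventually_lt_const hε₀] with n hn θ hθ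
    exact le_trans (show ‖GMM.popMoment P₀ ρ θ‖ ≤ K / Real.sqrt n from hθ) hn.le
  have hG := fun (K : ℝ) (hK : 0 < K) =>
    GMM.uniformlySmall_empiricalProcess_sub hX hρ_int hD hstar (hN K hK) (hs K hK)
  refine ⟨GMM.hasLocalGMMExpansion_of_uniformlySmall hX hdk hρ_meas hρ_int hΩ hblock' hL2 hθstar
    hcov hd' hG (W := fun n ω θ => W n (GMM.sample X n ω) θ) fun K hK => ?_, fun What hWhat =>
    GMM.hasLocalGMMExpansion_of_uniformlySmall hX hdk hρ_meas hρ_int hΩ hblock' hL2 hθstar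
      hcov hd' hG (W := fun n ω _ => What n ω) fun K hK => ?_⟩
  · have hvar := fun p : Fin k × Fin k => GMM.uniformlySmall_sampleVariance_sub hX hρ_int hD hstar
      (hN K hK) (hs K hK) hstar0 p.1 p.2
    -- Entrywise closeness of the sample variance to `Ω` controls every generalized inverse at once,
    -- so neither a particular choice of `W` nor its measurability matters.
    refine GMM.UniformlySmall.of_finite hvar fun ε hε => ?_
    obtain ⟨η, hη, h⟩ := GMM.exists_generalizedInverse_close hΩ hε
    refine ⟨η, hη, Eventually.of_forall fun n ω hω θ hθ =>
      h (GMM.sampleVariance ρ n (GMM.sample X n ω) θ) _ (fun a b => ?_) (hW n _ θ)⟩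
    rw [← hcov a b]
    exact hω θ hθ (a, b)
  · simpa using GMM.UniformlySmall.of_tendstoInMeasure
      (N := fun n => GMM.enlargement P₀ ρ (K / Real.sqrt n)) hWhat
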